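/- Let $\mathbb C_\theta=\{s\in\mathbb C:\operatorname{Re}s>\theta\}$. Let $\mathcal H$ be the Hilbert space of Dirichlet series $f(s)=\sum_{n\ge1}a_nn^{-s}$ with $\|f\|=(\sum_{n\ge1}|a_n|^2)^{1/2}<\infty$, whose elements are analytic functions on $\mathbb C_{1/2}$. Let $\mathcal C(\mathcal H)$ be the set of all bounded composition operators $C_\varphi f=f\circ\varphi$ on $\mathcal H$, where $\varphi$ is an analytic self-map of $\mathbb C_{1/2}$, with the topology of the operator norm. The Gordon--Hedenmalm class $\mathcal G$ consists of the maps $\varphi:\mathbb C_{1/2}\to\mathbb C_{1/2}$ of the form $\varphi(s)=c_0s+\psi(s)$, where $c_0$ is a non-negative integer (the characteristic of $\varphi$) and $\psi(s)=\sum_{n\ge1}c_nn^{-s}$ converges uniformly in $\mathbb C_\varepsilon$ for every $\varepsilon>0$, such that $\psi(\mathbb C_0)\subseteq\mathbb C_{1/2}$ if $c_0=0$, and, if $c_0\ge1$, either $\psi\equiv c_1$ with $\operatorname{Re}c_1\ge0$ or $\psi(\mathbb C_0)\subseteq\mathbb C_0$. Such a $\varphi$ is regarded as a function on $\mathbb C_0$.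 **Theorem.** Let $\varphi_0,\varphi_1\in\mathcal G$ both have characteristic zero, and put $$m(s)=\min\left(\frac{\operatorname{Re}\varphi_0(s)-1/2}{|1+\varphi_0(s)|^2},\ \frac{\operatorname{Re}\varphi_1(s)-1/2}{|1+\varphi_1(s)|^2}\right),\qquad s\in\mathbb C_0.$$ Assume that there is a constant $C>0$ such that $|\varphi_0(s)-\varphi_1(s)|\le C\,m(s)$ for all $s\in\mathbb C_0$. Then $C_{\varphi_0}$ and $C_{\varphi_1}$ (which are bounded on $\mathcal H$) belong to the same connected component of $\mathcal C(\mathcal H)$. If, moreover, $|\varphi_0-\varphi_1|=o(m)$ as $m\to0$, that is, for every $\varepsilon>0$ there is $\delta>0$ such that $|\varphi_0(s)-\varphi_1(s)|\le\varepsilon\,m(s)$ for all $s\in\mathbb C_0$ with $m(s)<\delta$, then $C_{\varphi_0}-C_{\varphi_1}$ is compact. -/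

import Mathlib

open Set Filter Topology Asymptotics

noncomputable section

namespace DirichletHardy

/-- The open half-plane of all complex numbers with real part larger than `θ`. -/
def halfPlane (θ : ℝ) : Set ℂ := {s : ℂ | θ < s.re}

/-- The Hardy-Hilbert space of Dirichlet series `∑_{n ≥ 1} a_n n^{-s}` with square summable
coefficients. An element is given by its coefficients `a_n`, `n ≥ 1`, and its norm is
`(∑ |a_n|²)^{1/2}`; the function that it defines on `Re s > 1/2` is `DirichletHardy.eval`. -/
abbrev HardySpace : Type := lp (fun _ : ℕ+ => ℂ) 2

/-- The value at `s` (with `Re s > 1/2`) of the Dirichlet series with coefficients `f`. The series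
converges absolutely there by the Cauchy-Schwarz inequality, see `summable_eval`. -/
def eval (f : HardySpace) (s : ℂ) : ℂ := ∑' n : ℕ+, f n * (n : ℂ) ^ (-s)

/-- The bounded operator `T` on the Hardy space is the composition operator `C_φ`, that is
`T f = f ∘ φ` on `Re s > 1/2` for all `f`. It is unique, see `IsCompositionOperator.unique`. -/
def IsCompositionOperator (φ : ℂ → ℂ) (T : HardySpace →L[ℂ] HardySpace) : Prop :=
  ∀ f : HardySpace, ∀ s ∈ halfPlane (1 / 2), eval (T f) s = eval f (φ s)

/-- The set `𝒞(ℋ)` of all bounded composition operators on the Hardy space induced by analytic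
self-maps of the half-plane `Re s > 1/2`. It carries the topology of the operator norm. -/
def compositionOperators : Set (HardySpace →L[ℂ] HardySpace) :=
  {T | ∃ φ : ℂ → ℂ, DifferentiableOn ℂ φ (halfPlane (1 / 2)) ∧
    MapsTo φ (halfPlane (1 / 2)) (halfPlane (1 / 2)) ∧ IsCompositionOperator φ T}

/-- `φ` belongs to the Gordon-Hedenmalm class and has characteristic `c₀`. Here `φ` stands for the
map on the whole half-plane `Re s > 0` that is given by `c₀ s + ψ(s)`, where the Dirichlet series
`ψ(s) = ∑_{n ≥ 1} c_n n^{-s}` converges uniformly on `Re s > ε` for all `ε > 0`. The values of `φ`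
outside `Re s > 0` are irrelevant, and so is `c 0`. -/
def IsGordonHedenmalm (φ : ℂ → ℂ) (c₀ : ℕ) : Prop :=
  MapsTo φ (halfPlane (1 / 2)) (halfPlane (1 / 2)) ∧
  ∃ (ψ : ℂ → ℂ) (c : ℕ → ℂ),
    (∀ s ∈ halfPlane 0, φ s = (c₀ : ℂ) * s + ψ s) ∧
    (∀ ε : ℝ, 0 < ε → TendstoUniformlyOn
      (fun (N : ℕ) (s : ℂ) => ∑ n ∈ Finset.Icc 1 N, c n * (n : ℂ) ^ (-s)) ψ atTop
      (halfPlane ε)) ∧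
    (c₀ = 0 → MapsTo ψ (halfPlane 0) (halfPlane (1 / 2))) ∧
    (1 ≤ c₀ → ((∀ s ∈ halfPlane 0, ψ s = c 1) ∧ 0 ≤ (c 1).re) ∨
      MapsTo ψ (halfPlane 0) (halfPlane 0))

/-- The function `min_i (Re φ_i(s) - 1/2) / |1 + φ_i(s)|²` of `s`. -/
def contactGauge (φ₀ φ₁ : ℂ → ℂ) (s : ℂ) : ℝ :=
  min (((φ₀ s).re - 1 / 2) / ‖1 + φ₀ s‖ ^ 2) (((φ₁ s).re - 1 / 2) / ‖1 + φ₁ s‖ ^ 2)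

theorem summable_eval (f : HardySpace) {s : ℂ} (hs : s ∈ halfPlane (1 / 2)) :
    Summable fun n : ℕ+ => f n * (n : ℂ) ^ (-s) := by
  have hs' : (1 : ℝ) / 2 < s.re := hs
  have h1 : Summable fun n : ℕ+ => ‖f n‖ ^ (2 : ℝ) := by
    simpa using (lp.memℓp f).summable (by norm_num)
  have h2 : Summable fun n : ℕ+ => ((n : ℝ) ^ (-s.re)) ^ (2 : ℝ) := by
    have h : Summable fun n : ℕ => (n : ℝ) ^ (-s.re * 2) :=
      Real.summable_nat_rpow.2 (by linarith)
    have h' := h.comp_injective PNat.coe_injective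
    refine h'.congr fun n => ?_
    rw [← Real.rpow_mul (by positivity)]
    rfl
  have h3 := Real.summable_mul_of_Lp_Lq_of_nonneg Real.HolderConjugate.two_two
    (fun n : ℕ+ => norm_nonneg (f n)) (fun n : ℕ+ => Real.rpow_nonneg (by positivity) _) h1 h2
  refine Summable.of_norm (h3.congr fun n => ?_)
  rw [norm_mul, Complex.norm_natCast_cpow_of_pos n.pos, Complex.neg_re]

theorem eval_injective {f g : HardySpace}
    (h : ∀ s ∈ halfPlane (1 / 2), eval f s = eval g s) : f = g := by
  have key : ∀ (u : HardySpace), ∃ a : ℕ → ℂ, (∀ n : ℕ+, a n = u n) ∧ a 0 = 0 ∧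
      ∀ s ∈ halfPlane (1 / 2), LSeriesHasSum a s (eval u s) := by
    intro u
    refine ⟨fun n => if hn : 0 < n then u ⟨n, hn⟩ else 0, fun n => ?_, by simp, fun s hs => ?_⟩
    · simp only [n.pos, dif_pos]
      rfl
    · have h1 := (summable_eval u hs).hasSum
      refine (PNat.coe_injective.hasSum_iff (f := LSeries.term _ s) ?_).1 (h1.congr_fun ?_)
      · intro n hn
        have : n = 0 := by
          by_contra h0
          exact hn ⟨⟨n, Nat.pos_of_ne_zero h0⟩, rfl⟩
        simp [this]
      · intro n
        simp [n.pos, Complex.cpow_neg, div_eq_mul_inv]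
        rfl
  obtain ⟨a, ha, ha0, has⟩ := key f
  obtain ⟨b, hb, hb0, hbs⟩ := key g
  have hlt : ∀ c : ℕ → ℂ, LSeriesSummable c 1 → LSeries.abscissaOfAbsConv c < ⊤ := fun c hc =>
    lt_of_le_of_lt hc.abscissaOfAbsConv_le (EReal.coe_lt_top _)
  have h1 : (1 : ℂ) ∈ halfPlane (1 / 2) := by
    norm_num [halfPlane]
  have hab : LSeries a =ᶠ[𝓟 (halfPlane (1 / 2))] LSeries b := by
    rw [EventuallyEq, eventually_principal]
    intro s hs
    rw [(has s hs).LSeries_eq, (hbs s hs).LSeries_eq, h s hs]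
  have hab' : (fun x : ℝ => LSeries a x) =ᶠ[atTop] fun x : ℝ => LSeries b x := by
    filter_upwards [eventually_gt_atTop (1 / 2 : ℝ)] with x hx
    exact (eventually_principal.1 hab) (x : ℂ) (by simpa [halfPlane] using hx)
  have hab2 : ∀ n : ℕ, n ≠ 0 → a n = b n := fun n hn =>
    LSeries.eq_of_LSeries_eventually_eq (hlt a (has 1 h1).LSeriesSummable)
      (hlt b (hbs 1 h1).LSeriesSummable) hab' hn
  ext n
  rw [← ha, ← hb, hab2 n n.ne_zero]

theorem IsCompositionOperator.unique {φ : ℂ → ℂ} {S T : HardySpace →L[ℂ] HardySpace}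
    (hS : IsCompositionOperator φ S) (hT : IsCompositionOperator φ T) : S = T :=
  ContinuousLinearMap.ext fun f => eval_injective fun s hs => by rw [hS f s hs, hT f s hs]

end DirichletHardy

end

/-! For a Dirichlet polynomial f(w) = ∑ a_n n^{-w} put M(w) = ∑_{k≥0} ((k+1)^{2 Re w - 1} - k^{2 Re
w - 1}) |∑_{n>k} a_n n^{-w}|². On Re w > 1/2 the weights are nonnegative and the term k = 0 is
|f(w)|². After expanding the squares, the sum over k telescopes, and each conjugate factor is
absorbed by the identity 2 Re w = w + conj w. So M is the real part of a holomorphic exponential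
sum: it is a harmonic majorant of |f|² (`majorant_eq`, `norm_sum_dterm_sq_le`).

Let φ have characteristic zero and constant term c. Uniform limits of Dirichlet polynomials are
stable under exponentials, so M ∘ φ is the real part of such a limit, and its mean on every vertical
line is M(c) (`hasMean_majorant_comp`). By Carlson's theorem the Hardy norm is controlled by
vertical means, whence ‖f ∘ φ‖² ≤ M(c). A Schur test gives M(c) ≤ (2/x) ‖f‖² whenever 0 < x ≤ 1 and
Re c ≥ 1/2 + x (`majorant_le`). This proves boundedness.

The majorant also controls differences: if Re v, Re w ≥ 1/2 + x, then (2x)² |f(v) - f(w)|² ≤ |v -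
w|² (M(v) + M(w)), by Abel summation and Cauchy-Schwarz (`norm_sum_dterm_sub_sq_le`). Hence symbols
whose distance is at most 2κ times their distance to the line Re = 1/2 induce operators at distance
O(κ). As the contact gauge is at most that distance to the line, the segment from φ₀ to φ₁ yields a
Lipschitz path of composition operators. For compactness, finitely many frequencies are projected
away: the remaining part of f is small where both symbols stay away from the line, and elsewhere the
little-o condition makes κ small. -/

noncomputable section

namespace DirichletHardy

/-! ### Mean values on the real line -/

section Mean

variable {E F : Type*} [NormedAddCommGroup E] [NormedSpace ℝ E] [NormedAddCommGroup F]
  [NormedSpace ℝ F]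

/-- The continuous function `h` on the real line has the asymptotic mean value `a`. -/
def HasMean (h : ℝ → E) (a : E) : Prop :=
  Continuous h ∧ Tendsto (fun T : ℝ => (2 * T)⁻¹ • ∫ t in (-T)..T, h t) atTop (𝓝 a)

theorem HasMean.add {h k : ℝ → E} {a b : E} (hh : HasMean h a) (hk : HasMean k b) :
    HasMean (fun t => h t + k t) (a + b) := by
  refine ⟨hh.1.add hk.1, (hh.2.add hk.2).congr fun T => ?_⟩
  rw [intervalIntegral.integral_add (hh.1.intervalIntegrable _ _) (hk.1.intervalIntegrable _ _),
    smul_add]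

theorem hasMean_const [CompleteSpace E] (a : E) : HasMean (fun _ => a) a := by
  refine ⟨continuous_const, (tendsto_const_nhds (x := a)).congr' ?_⟩
  filter_upwards [eventually_gt_atTop 0] with T hT
  rw [intervalIntegral.integral_const, smul_smul]
  have : (2 * T)⁻¹ * (T - -T) = 1 := by
    field_simp
    ring
  rw [this, one_smul]

theorem HasMean.map [CompleteSpace E] [CompleteSpace F] {h : ℝ → E} {a : E} (hh : HasMean h a)
    (L : E →L[ℝ] F) : HasMean (fun t => L (h t)) (L a) := by
  refine ⟨L.continuous.comp hh.1, ((L.continuous.tendsto a).comp hh.2).congr fun T => ?_⟩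
  rw [L.intervalIntegral_comp_comm (hh.1.intervalIntegrable _ _)]
  simp

theorem HasMean.const_mul {h : ℝ → ℂ} {a : ℂ} (hh : HasMean h a) (c : ℂ) :
    HasMean (fun t => c * h t) (c * a) :=
  hh.map ((ContinuousLinearMap.mul ℂ ℂ c).restrictScalars ℝ)

theorem HasMean.real_const_mul {h : ℝ → ℝ} {a : ℝ} (hh : HasMean h a) (c : ℝ) :
    HasMean (fun t => c * h t) (c * a) :=
  hh.map (ContinuousLinearMap.mul ℝ ℝ c)

theorem HasMean.re {h : ℝ → ℂ} {a : ℂ} (hh : HasMean h a) : HasMean (fun t => (h t).re) a.re :=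
  hh.map Complex.reCLM

theorem HasMean.mono {h k : ℝ → ℝ} {a b : ℝ} (hh : HasMean h a) (hk : HasMean k b)
    (hle : ∀ t, h t ≤ k t) : a ≤ b := by
  refine le_of_tendsto_of_tendsto hh.2 hk.2 ?_
  filter_upwards [eventually_gt_atTop 0] with T hT
  simp only [smul_eq_mul]
  gcongr
  exact intervalIntegral.integral_mono_on (by linarith) (hh.1.intervalIntegrable _ _)
    (hk.1.intervalIntegrable _ _) fun t _ => hle t

theorem HasMean.of_tendstoUniformly {h : ℕ → ℝ → E} {a : ℕ → E} {g : ℝ → E} {b : E}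
    (hh : ∀ N, HasMean (h N) (a N)) (hg : TendstoUniformly h g atTop)
    (ha : Tendsto a atTop (𝓝 b)) : HasMean g b := by
  have hgc : Continuous g := hg.continuous (Eventually.frequently (Eventually.of_forall
    fun N => (hh N).1))
  refine ⟨hgc, Metric.tendsto_nhds.2 fun ε hε => ?_⟩
  obtain ⟨N, hN1, hN2⟩ := ((Metric.tendstoUniformly_iff.1 hg (ε / 3) (by positivity)).and
    (Metric.tendsto_nhds.1 ha (ε / 3) (by positivity))).exists
  filter_upwards [Metric.tendsto_nhds.1 (hh N).2 (ε / 3) (by positivity), eventually_gt_atTop 0]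
    with T hT hT0
  have h1 : dist ((2 * T)⁻¹ • ∫ t in (-T)..T, g t) ((2 * T)⁻¹ • ∫ t in (-T)..T, h N t)
      ≤ ε / 3 := by
    rw [dist_eq_norm, ← smul_sub, ← intervalIntegral.integral_sub (hgc.intervalIntegrable _ _)
      ((hh N).1.intervalIntegrable _ _), norm_smul, Real.norm_of_nonneg (by positivity)]
    have h2 : ‖∫ t in (-T)..T, (g t - h N t)‖ ≤ ε / 3 * |T - -T| :=
      intervalIntegral.norm_integral_le_of_norm_le_const fun t _ => by
        rw [← dist_eq_norm]
        exact (hN1 t).le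
    rw [abs_of_pos (by linarith)] at h2
    calc (2 * T)⁻¹ * ‖∫ t in (-T)..T, (g t - h N t)‖
        ≤ (2 * T)⁻¹ * (ε / 3 * (T - -T)) := by gcongr
      _ = ε / 3 := by
        field_simp
        ring
  calc _ ≤ _ := dist_triangle4 _ ((2 * T)⁻¹ • ∫ t in (-T)..T, h N t) (a N) _
    _ < ε / 3 + ε / 3 + ε / 3 := by linarith
    _ = ε := by ring

theorem hasMean_exp {L : ℝ} (hL : L ≠ 0) :
    HasMean (fun t : ℝ => Complex.exp ((L * Complex.I) * t)) 0 := by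
  refine ⟨by fun_prop, ?_⟩
  have hc : (L * Complex.I : ℂ) ≠ 0 := by simp [hL]
  have hn : ∀ T : ℝ, ‖Complex.exp ((L * Complex.I) * T)‖ = 1 := fun T => by
    rw [Complex.norm_exp]
    simp
  have h0 : Tendsto (fun T : ℝ => (2 * T)⁻¹ * (2 / |L|)) atTop (𝓝 0) := by
    simpa using (tendsto_inv_atTop_zero.comp
      (tendsto_id.const_mul_atTop (two_pos : (0 : ℝ) < 2))).mul_const (2 / |L|)
  refine squeeze_zero_norm' ?_ h0
  filter_upwards [eventually_gt_atTop 0] with T hT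
  -- The integral of the oscillating exponential is at most 2/|L| for every T, so the factor 1/(2T)
  -- sends the mean to zero.
  rw [norm_smul, Real.norm_of_nonneg (by positivity), integral_exp_mul_complex hc, norm_div]
  gcongr
  · calc _ ≤ _ := norm_sub_le _ _
      _ = 2 := by rw [hn, hn]; norm_num
  · simp

end Mean

/-! ### Dirichlet polynomials -/

/-- Dirichlet polynomials `∑ c_n n^{-s}`, given by their coefficients. -/
abbrev DirichletPoly : Type := MonoidAlgebra ℂ ℕ+

/-- The value of a Dirichlet polynomial at a point. -/
def evalAt (s : ℂ) : DirichletPoly →ₐ[ℂ] ℂ :=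
  MonoidAlgebra.lift ℂ ℂ ℕ+
    { toFun := fun n => (n : ℂ) ^ (-s)
      map_one' := by simp
      map_mul' := fun m n => by
        have := Complex.natCast_mul_natCast_cpow m n (-s)
        simpa using this }

/-- The first coefficient of a Dirichlet polynomial, its limit as `Re s → ∞`. -/
def leading : DirichletPoly →ₐ[ℂ] ℂ :=
  MonoidAlgebra.lift ℂ ℂ ℕ+
    { toFun := fun n => if n = 1 then 1 else 0
      map_one' := by simp
      map_mul' := fun m n => by
        -- The constant term is multiplicative because 1 has no nontrivial factorization in `ℕ+`.
        have : m * n = 1 ↔ m = 1 ∧ n = 1 := by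
          rw [← PNat.coe_inj, PNat.mul_coe, PNat.one_coe, mul_eq_one, PNat.coe_eq_one_iff,
            PNat.coe_eq_one_iff]
        simp only [this]
        split_ifs <;> simp_all }

@[simp] theorem evalAt_single (s : ℂ) (n : ℕ+) (c : ℂ) :
    evalAt s (MonoidAlgebra.single n c) = c * (n : ℂ) ^ (-s) := by
  simp [evalAt]

@[simp] theorem leading_single (n : ℕ+) (c : ℂ) :
    leading (MonoidAlgebra.single n c) = if n = 1 then c else 0 := by
  simp [leading]

theorem differentiable_evalAt (p : DirichletPoly) : Differentiable ℂ fun s => evalAt s p := by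
  induction p using MonoidAlgebra.induction_linear with
  | zero => simp
  | add p q hp hq =>
    simp only [map_add]
    exact hp.add hq
  | single n c =>
    simp only [evalAt_single]
    have : (n : ℂ) ≠ 0 := by exact_mod_cast n.ne_zero
    exact (differentiable_neg.const_cpow (Or.inl this)).const_mul _

theorem exists_bound_evalAt (p : DirichletPoly) :
    ∃ B : ℝ, (∀ s ∈ halfPlane 0, ‖evalAt s p‖ ≤ B) ∧ ‖leading p‖ ≤ B := by
  induction p using MonoidAlgebra.induction_linear with
  | zero => exact ⟨0, by simp⟩
  | add p q hp hq =>
    obtain ⟨B, hB, hB'⟩ := hp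
    obtain ⟨D, hD, hD'⟩ := hq
    refine ⟨B + D, fun s hs => ?_, ?_⟩
    · rw [map_add]
      exact norm_add_le_of_le (hB s hs) (hD s hs)
    · rw [map_add]
      exact norm_add_le_of_le hB' hD'
  | single n c =>
    refine ⟨‖c‖, fun s hs => ?_, ?_⟩
    · rw [evalAt_single, norm_mul, Complex.norm_natCast_cpow_of_pos n.pos]
      have hs' : 0 < s.re := hs
      refine mul_le_of_le_one_right (norm_nonneg c) ?_
      refine Real.rpow_le_one_of_one_le_of_nonpos ?_ ?_
      · exact_mod_cast Nat.one_le_iff_ne_zero.2 n.ne_zero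
      · simpa using hs'.le
    · rw [leading_single]
      split_ifs <;> simp

/-- The element `∑ c_n n^{-σ} n^{-s}` of the Hardy space, where `p` has the coefficients `c_n`. -/
def shift (σ : ℝ) : DirichletPoly →ₗ[ℂ] HardySpace :=
  (Finsupp.linearCombination ℂ fun n : ℕ+ =>
    (lp.single 2 n ((n : ℂ) ^ (-(σ : ℂ))) : HardySpace)) ∘ₗ
    (MonoidAlgebra.coeffLinearEquiv ℂ (S := ℂ) (M := ℕ+)).toLinearMap

theorem shift_single (σ : ℝ) (n : ℕ+) (c : ℂ) :
    shift σ (MonoidAlgebra.single n c) = lp.single 2 n (c * (n : ℂ) ^ (-(σ : ℂ))) := by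
  simp [shift, ← lp.single_smul]

theorem shift_apply (σ : ℝ) (p : DirichletPoly) (n : ℕ+) :
    shift σ p n = p.coeff n * (n : ℂ) ^ (-(σ : ℂ)) := by
  induction p using MonoidAlgebra.induction_linear with
  | zero => simp
  | add p q hp hq => simp [hp, hq, add_mul]
  | single m c =>
    rw [shift_single, lp.single_apply, MonoidAlgebra.coeff_single, Finsupp.single_apply,
      Pi.single_apply]
    by_cases h : m = n
    · subst h
      simp
    · simp [h, Ne.symm h]

theorem norm_rpow_neg_pnat (n : ℕ+) (s : ℂ) : ‖(n : ℂ) ^ (-s)‖ = (n : ℝ) ^ (-s.re) := by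
  rw [Complex.norm_natCast_cpow_of_pos n.pos, Complex.neg_re]

/-- Carlson's theorem in polarized form. By sesquilinearity two monomials suffice; their product on
the vertical line is a constant times exp(it log(m/n)), which has mean zero unless m = n. -/
theorem hasMean_evalAt_mul_conj (σ : ℝ) (p q : DirichletPoly) :
    HasMean (fun t : ℝ => evalAt (σ + t * Complex.I) p *
      (starRingEnd ℂ) (evalAt (σ + t * Complex.I) q)) (inner ℂ (shift σ q) (shift σ p)) := by
  induction p using MonoidAlgebra.induction_linear with
  | zero => simpa using hasMean_const (0 : ℂ)
  | add p p' hp hp' => simpa [add_mul, inner_add_right] using hp.add hp'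
  | single n c =>
    induction q using MonoidAlgebra.induction_linear with
    | zero => simpa using hasMean_const (0 : ℂ)
    | add q q' hq hq' => simpa [mul_add, inner_add_left] using hq.add hq'
    | single m d =>
      rw [shift_single, shift_single, lp.inner_single_left, lp.single_apply, Pi.single_apply]
      have hn0 : (n : ℂ) ≠ 0 := by exact_mod_cast n.ne_zero
      have hm0 : (m : ℂ) ≠ 0 := by exact_mod_cast m.ne_zero
      have hlog : ∀ k : ℕ+, Complex.log (k : ℂ) = (Real.log k : ℝ) := fun k => by
        rw [Complex.natCast_log]
      have key : ∀ t : ℝ, evalAt (σ + t * Complex.I) (MonoidAlgebra.single n c) *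
          (starRingEnd ℂ) (evalAt (σ + t * Complex.I) (MonoidAlgebra.single m d)) =
          (c * (n : ℂ) ^ (-(σ : ℂ)) * (starRingEnd ℂ) (d * (m : ℂ) ^ (-(σ : ℂ)))) *
            Complex.exp (((Real.log m - Real.log n : ℝ) * Complex.I) * t) := by
        intro t
        simp only [evalAt_single, Complex.cpow_def_of_ne_zero hn0, Complex.cpow_def_of_ne_zero hm0,
          hlog, map_mul, ← Complex.exp_conj, map_neg, map_add, Complex.conj_ofReal, Complex.conj_I]
        have he : Complex.exp ((Real.log n : ℝ) * -(σ + t * Complex.I)) *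
            Complex.exp ((Real.log m : ℝ) * -(σ + t * -Complex.I)) =
            Complex.exp ((Real.log n : ℝ) * -(σ : ℂ)) * Complex.exp ((Real.log m : ℝ) * -(σ : ℂ)) *
              Complex.exp (((Real.log m - Real.log n : ℝ) * Complex.I) * t) := by
          rw [← Complex.exp_add, ← Complex.exp_add, ← Complex.exp_add]
          congr 1
          push_cast
          ring
        linear_combination (c * (starRingEnd ℂ) d) * he
      simp only [key]
      by_cases h : m = n
      · subst h
        simpa using hasMean_const
          (c * (m : ℂ) ^ (-(σ : ℂ)) * (starRingEnd ℂ) (d * (m : ℂ) ^ (-(σ : ℂ))))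
      · have hL : Real.log m - Real.log n ≠ 0 := by
          intro h0
          apply h
          have := Real.log_injOn_pos (by simp) (by simp) (sub_eq_zero.1 h0)
          exact_mod_cast this
        simpa [h] using (hasMean_exp hL).const_mul _

theorem hasMean_normSq_evalAt (σ : ℝ) (p : DirichletPoly) :
    HasMean (fun t : ℝ => ‖evalAt (σ + t * Complex.I) p‖ ^ 2) (‖shift σ p‖ ^ 2) := by
  have := (hasMean_evalAt_mul_conj σ p p).re
  simp only [Complex.mul_conj', inner_self_eq_norm_sq_to_K] at this
  convert this using 1
  · ext t
    rw [← Complex.ofReal_pow, Complex.ofReal_re]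
  · exact (Complex.ofReal_re _).symm.trans (by push_cast; rfl)

theorem hasMean_evalAt (σ : ℝ) (p : DirichletPoly) :
    HasMean (fun t : ℝ => evalAt (σ + t * Complex.I) p) (leading p) := by
  have h := hasMean_evalAt_mul_conj σ p 1
  have h1 : inner ℂ (shift σ 1) (shift σ p) = leading p := by
    clear h
    rw [MonoidAlgebra.one_def, shift_single, lp.inner_single_left, shift_apply]
    induction p using MonoidAlgebra.induction_linear with
    | zero => simp
    | add p q hp hq => simp_all
    | single m c =>
      simp [Finsupp.single_apply]
  simpa [h1] using h

/-! ### Point evaluations on the Hardy space -/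

theorem eval_single {s : ℂ} (n : ℕ+) (c : ℂ) :
    eval (lp.single 2 n c) s = c * (n : ℂ) ^ (-s) := by
  rw [eval, tsum_eq_single n]
  · simp
  · intro m hm
    simp [lp.single_apply, hm]

theorem eval_add {s : ℂ} (hs : s ∈ halfPlane (1 / 2)) (f g : HardySpace) :
    eval (f + g) s = eval f s + eval g s := by
  rw [eval, eval, eval, ← (summable_eval f hs).tsum_add (summable_eval g hs)]
  simp [add_mul]

theorem eval_smul {s : ℂ} (c : ℂ) (f : HardySpace) :
    eval (c • f) s = c * eval f s := by
  rw [eval, eval, ← tsum_mul_left]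
  simp [mul_assoc]

theorem eval_sub {s : ℂ} (hs : s ∈ halfPlane (1 / 2)) (f g : HardySpace) :
    eval (f - g) s = eval f s - eval g s := by
  rw [sub_eq_add_neg, ← neg_one_smul ℂ g, eval_add hs, eval_smul]
  ring

theorem eval_shift (σ : ℝ) (p : DirichletPoly) {s : ℂ} (hs : s ∈ halfPlane (1 / 2)) :
    eval (shift σ p) s = evalAt (s + σ) p := by
  induction p using MonoidAlgebra.induction_linear with
  | zero => simp [eval]
  | add p q hp hq => simp [hp, hq, eval_add hs]
  | single n c =>
    have hn0 : (n : ℂ) ≠ 0 := by exact_mod_cast n.ne_zero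
    rw [shift_single, eval_single, evalAt_single, mul_assoc, ← Complex.cpow_add _ _ hn0]
    congr 2
    ring

/-- The tail `∑_{n ≥ 1, n ∉ S} n^{-2θ}`. -/
def tailSum (θ : ℝ) (S : Finset ℕ+) : ℝ := ∑' n : {n : ℕ+ // n ∉ S}, ((n : ℕ+) : ℝ) ^ (-(2 * θ))

theorem tailSum_nonneg (θ : ℝ) (S : Finset ℕ+) : 0 ≤ tailSum θ S :=
  tsum_nonneg fun n => by positivity

theorem summable_pnat_rpow {θ : ℝ} (hθ : 1 / 2 < θ) :
    Summable fun n : ℕ+ => (n : ℝ) ^ (-(2 * θ)) :=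
  (Real.summable_nat_rpow.2 (by linarith : -(2 * θ) < -1)).comp_injective PNat.coe_injective

theorem tendsto_tailSum (θ : ℝ) : Tendsto (tailSum θ) atTop (𝓝 0) :=
  tendsto_tsum_compl_atTop_zero fun n : ℕ+ => (n : ℝ) ^ (-(2 * θ))

/-- Cauchy-Schwarz against n^{-θ} restricted to the complement of `S`. The case `S = ∅` gives
continuity of point evaluations; large `S` gives the uniform smallness of high frequencies needed
for compactness. -/
theorem norm_eval_sq_le {θ : ℝ} (hθ : 1 / 2 < θ) {s : ℂ} (hs : θ ≤ s.re) (S : Finset ℕ+)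
    (f : HardySpace) (hf : ∀ n ∈ S, f n = 0) :
    ‖eval f s‖ ^ 2 ≤ tailSum θ S * ‖f‖ ^ 2 := by
  set w : ℕ+ → ℝ := {n : ℕ+ | n ∉ S}.indicator fun n => (n : ℝ) ^ (-θ) with hw
  have hw0 : ∀ n, 0 ≤ w n := fun n => indicator_nonneg (fun n _ => by positivity) n
  have hw2 : ∀ n, w n ^ (2 : ℝ) = {n : ℕ+ | n ∉ S}.indicator
      (fun n : ℕ+ => (n : ℝ) ^ (-(2 * θ))) n := fun n => by
    by_cases hn : n ∈ S
    · simp [hw, hn]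
    · simp only [hw, indicator, mem_ofPred_eq, hn, not_false_eq_true, if_true]
      rw [← Real.rpow_mul (by positivity)]
      congr 1
      ring
  have hf2 : ∀ n, ‖f n‖ ^ (2 : ℝ) = ‖f n‖ ^ 2 := fun n => by norm_cast
  have h1 : Summable fun n : ℕ+ => ‖f n‖ ^ (2 : ℝ) := by
    simpa using (lp.memℓp f).summable (by norm_num)
  have h2 : Summable fun n : ℕ+ => w n ^ (2 : ℝ) := by
    simp only [hw2]
    exact (summable_pnat_rpow hθ).indicator _
  have h3 := Real.summable_mul_of_Lp_Lq_of_nonneg Real.HolderConjugate.two_two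
    (fun n : ℕ+ => norm_nonneg (f n)) hw0 h1 h2
  have h4 := Real.inner_le_Lp_mul_Lq_tsum_of_nonneg Real.HolderConjugate.two_two
    (fun n : ℕ+ => norm_nonneg (f n)) hw0 h1 h2
  have h5 : ‖eval f s‖ ≤ ∑' n, ‖f n‖ * w n := by
    refine tsum_of_norm_bounded h3.hasSum fun n => ?_
    rw [norm_mul, norm_rpow_neg_pnat]
    by_cases hn : n ∈ S
    · simp [hf n hn]
    · simp only [hw, indicator, mem_ofPred_eq, hn, not_false_eq_true, if_true]
      gcongr
      exact_mod_cast Nat.one_le_iff_ne_zero.2 n.ne_zero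
  have h6 : ∑' n, ‖f n‖ ^ (2 : ℝ) = ‖f‖ ^ 2 := by
    have := lp.norm_rpow_eq_tsum (p := 2) (by norm_num) f
    simp only [ENNReal.toReal_ofNat] at this
    rw [← this]
    norm_cast
  have h7 : ∑' n, w n ^ (2 : ℝ) = tailSum θ S := by
    simp only [hw2]
    exact (tsum_subtype {n : ℕ+ | n ∉ S} fun n : ℕ+ => (n : ℝ) ^ (-(2 * θ))).symm
  rw [h6, h7, ← Real.sqrt_eq_rpow, ← Real.sqrt_eq_rpow, Real.sqrt_sq (norm_nonneg _)] at h4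
  calc ‖eval f s‖ ^ 2 ≤ (‖f‖ * √(tailSum θ S)) ^ 2 := by
        gcongr
        exact h5.trans h4
    _ = tailSum θ S * ‖f‖ ^ 2 := by rw [mul_pow, Real.sq_sqrt (tailSum_nonneg _ _), mul_comm]

theorem continuous_eval {s : ℂ} (hs : s ∈ halfPlane (1 / 2)) :
    Continuous fun f : HardySpace => eval f s := by
  have hC : ∀ f g : HardySpace, dist (eval f s) (eval g s) ≤ √(tailSum s.re ∅) * dist f g := by
    intro f g
    rw [dist_eq_norm, dist_eq_norm, ← eval_sub hs, ← Real.sqrt_sq (norm_nonneg (f - g)),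
      ← Real.sqrt_mul (tailSum_nonneg _ _)]
    exact Real.le_sqrt_of_sq_le (norm_eval_sq_le hs le_rfl ∅ _ (by simp))
  exact (LipschitzWith.of_dist_le' hC).continuous

/-! ### Uniform limits of Dirichlet polynomials -/

/-- `g` is the limit of a sequence of Dirichlet polynomials, uniformly on `Re s > ε` for all
`ε > 0`, and the first coefficients converge to `a`. -/
def IsUniformLimit (g : ℂ → ℂ) (a : ℂ) : Prop :=
  ∃ p : ℕ → DirichletPoly, (∀ ε : ℝ, 0 < ε →
    TendstoUniformlyOn (fun N s => evalAt s (p N)) g atTop (halfPlane ε)) ∧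
    Tendsto (fun N => leading (p N)) atTop (𝓝 a)

theorem halfPlane_subset {ε δ : ℝ} (h : δ ≤ ε) : halfPlane ε ⊆ halfPlane δ :=
  fun _ hs => lt_of_le_of_lt h hs

theorem isUniformLimit_const (c : ℂ) : IsUniformLimit (fun _ => c) c := by
  refine ⟨fun _ => MonoidAlgebra.single 1 c, fun ε hε => ?_, by simp⟩
  simpa using (tendsto_const_nhds (x := c) (f := atTop (α := ℕ))).tendstoUniformlyOn_const
    (halfPlane ε)

theorem IsUniformLimit.add {g h : ℂ → ℂ} {a b : ℂ} (hg : IsUniformLimit g a)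
    (hh : IsUniformLimit h b) : IsUniformLimit (fun s => g s + h s) (a + b) := by
  obtain ⟨p, hp, hp'⟩ := hg
  obtain ⟨q, hq, hq'⟩ := hh
  refine ⟨fun N => p N + q N, fun ε hε => ?_, by simpa using hp'.add hq'⟩
  simp only [map_add]
  exact (hp ε hε).add (hq ε hε)

theorem IsUniformLimit.const_mul {g : ℂ → ℂ} {a : ℂ} (hg : IsUniformLimit g a) (c : ℂ) :
    IsUniformLimit (fun s => c * g s) (c * a) := by
  obtain ⟨p, hp, hp'⟩ := hg
  refine ⟨fun N => c • p N, fun ε hε => ?_, by simpa using hp'.const_mul c⟩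
  simp only [map_smul, smul_eq_mul]
  exact (uniformContinuous_const_smul c).comp_tendstoUniformlyOn (hp ε hε)

theorem IsUniformLimit.sub {g h : ℂ → ℂ} {a b : ℂ} (hg : IsUniformLimit g a)
    (hh : IsUniformLimit h b) : IsUniformLimit (fun s => g s - h s) (a - b) := by
  simpa [sub_eq_add_neg] using hg.add (hh.const_mul (-1))

theorem IsUniformLimit.sum {ι : Type*} (S : Finset ι) {g : ι → ℂ → ℂ} {a : ι → ℂ}
    (hg : ∀ i ∈ S, IsUniformLimit (g i) (a i)) :
    IsUniformLimit (fun s => ∑ i ∈ S, g i s) (∑ i ∈ S, a i) := by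
  induction S using Finset.cons_induction with
  | empty => simpa using isUniformLimit_const 0
  | cons i S hi ih =>
    simp only [Finset.sum_cons]
    exact (hg i (by simp)).add (ih fun j hj => hg j (by simp [hj]))

theorem IsUniformLimit.congr {g h : ℂ → ℂ} {a : ℂ} (hg : IsUniformLimit g a)
    (hgh : ∀ s ∈ halfPlane 0, g s = h s) : IsUniformLimit h a := by
  obtain ⟨p, hp, hp'⟩ := hg
  exact ⟨p, fun ε hε => (hp ε hε).congr_right fun s hs =>
    hgh s (halfPlane_subset hε.le hs), hp'⟩

theorem exists_bound_of_tendstoUniformlyOn {p : ℕ → DirichletPoly} {g : ℂ → ℂ} {ε : ℝ}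
    (hε : 0 < ε) (hp : TendstoUniformlyOn (fun N s => evalAt s (p N)) g atTop (halfPlane ε)) :
    ∃ B : ℝ, ∀ s ∈ halfPlane ε, ‖g s‖ ≤ B := by
  obtain ⟨N, hN⟩ := (Metric.tendstoUniformlyOn_iff.1 hp 1 one_pos).exists
  obtain ⟨B, hB, -⟩ := exists_bound_evalAt (p N)
  refine ⟨1 + B, fun s hs => ?_⟩
  have h1 := (hN s hs).le
  rw [dist_eq_norm] at h1
  have h2 := norm_add_le_of_le h1 (hB s (halfPlane_subset hε.le hs))
  simpa using h2

theorem TendstoUniformlyOn.comp_of_bounded {α E : Type*} [PseudoMetricSpace E] {S : Set α}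
    {q : ℕ → α → ℂ} {g : α → ℂ} {B : ℝ} (hq : TendstoUniformlyOn q g atTop S)
    (hB : ∀ s ∈ S, ‖g s‖ ≤ B) {F : ℂ → E} (hF : Continuous F) :
    TendstoUniformlyOn (fun N s => F (q N s)) (fun s => F (g s)) atTop S := by
  refine UniformContinuousOn.comp_tendstoUniformlyOn_eventually
    -- The extra 1 makes room for the approximants, which are eventually within distance 1 of `g`.
    (s := Metric.closedBall 0 (B + 1)) ?_ ?_
    ((isCompact_closedBall _ _).uniformContinuousOn_of_continuous hF.continuousOn) hq
  · filter_upwards [Metric.tendstoUniformlyOn_iff.1 hq 1 one_pos] with N hN s hs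
    have h1 := (hN s hs).le
    rw [dist_eq_norm, norm_sub_rev] at h1
    simpa [add_comm] using norm_add_le_of_le h1 (hB s hs)
  · intro s hs
    simpa using (hB s hs).trans (by linarith)

/-- Taylor polynomials of exp in `p` are again Dirichlet polynomials, and their error at any z with
|z| ≤ B is at most the Taylor remainder at B. The same B serves the values and the constant term. -/
theorem exists_dirichletPoly_exp (p : DirichletPoly) {η : ℝ} (hη : 0 < η) :
    ∃ q : DirichletPoly, (∀ s ∈ halfPlane 0, ‖evalAt s q - Complex.exp (evalAt s p)‖ ≤ η) ∧
      ‖leading q - Complex.exp (leading p)‖ ≤ η := by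
  obtain ⟨B, hB, hB'⟩ := exists_bound_evalAt p
  have hexp : ∀ x : ℝ, HasSum (fun m : ℕ => x ^ m / (m.factorial : ℝ)) (Real.exp x) := fun x => by
    rw [Real.exp_eq_exp_ℝ]
    exact NormedSpace.expSeries_div_hasSum_exp x
  have hlim : Tendsto (fun K => Real.exp B - ∑ m ∈ Finset.range K, B ^ m / (m.factorial : ℝ))
      atTop (𝓝 0) := by
    have := (hexp B).tendsto_sum_nat
    simpa using this.const_sub (Real.exp B)
  have hBs : ∀ (K : ℕ) (z : ℂ), ‖z‖ ≤ B →
      ‖∑ m ∈ Finset.range K, z ^ m / (m.factorial : ℂ) - Complex.exp z‖ ≤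
        Real.exp B - ∑ m ∈ Finset.range K, B ^ m / (m.factorial : ℝ) := by
    intro K z hz
    rw [norm_sub_rev]
    refine (Complex.norm_exp_sub_sum_le_exp_norm_sub_sum z K).trans ?_
    have h1 := hexp B
    have h2 := hexp ‖z‖
    rw [← h1.tsum_eq, ← h2.tsum_eq, ← h1.summable.sum_add_tsum_nat_add K,
      ← h2.summable.sum_add_tsum_nat_add K, add_sub_cancel_left, add_sub_cancel_left]
    refine ((summable_nat_add_iff K).2 h2.summable).tsum_le_tsum (fun m => ?_)
      ((summable_nat_add_iff K).2 h1.summable)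
    gcongr
  obtain ⟨K, hK⟩ := (hlim.eventually_le_const hη).exists
  refine ⟨∑ m ∈ Finset.range K, ((m.factorial : ℂ)⁻¹) • p ^ m, fun s hs => ?_, ?_⟩
  · have := (hBs K _ (hB s hs)).trans hK
    simpa [div_eq_inv_mul] using this
  · have := (hBs K _ hB').trans hK
    simpa [div_eq_inv_mul] using this

/-- This closure property is why arbitrary approximating polynomials are allowed instead of partial
sums: it makes n^{-φ} = exp(-φ log n) available without any convergence question for its own
Dirichlet series. -/
theorem IsUniformLimit.exp {g : ℂ → ℂ} {a : ℂ} (hg : IsUniformLimit g a) :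
    IsUniformLimit (fun s => Complex.exp (g s)) (Complex.exp a) := by
  obtain ⟨p, hp, hp'⟩ := hg
  choose q hq hq' using fun N : ℕ =>
    exists_dirichletPoly_exp (p N) (Nat.one_div_pos_of_nat (α := ℝ) (n := N))
  have h0 : Tendsto (fun N : ℕ => 1 / ((N : ℝ) + 1)) atTop (𝓝 0) :=
    tendsto_one_div_add_atTop_nhds_zero_nat
  refine ⟨q, fun ε hε => ?_, ?_⟩
  · obtain ⟨B, hB⟩ := exists_bound_of_tendstoUniformlyOn hε (hp ε hε)
    have h1 := TendstoUniformlyOn.comp_of_bounded (hp ε hε) hB Complex.continuous_exp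
    rw [Metric.tendstoUniformlyOn_iff] at h1 ⊢
    intro η hη
    filter_upwards [h1 (η / 2) (by positivity), h0.eventually_lt_const (half_pos hη)]
      with N hN hN' s hs
    have h2 := hq N s (halfPlane_subset hε.le hs)
    rw [← dist_eq_norm, dist_comm] at h2
    calc _ ≤ _ := dist_triangle _ (Complex.exp (evalAt s (p N))) _
      _ < η / 2 + η / 2 := by linarith [hN s hs]
      _ = η := by ring
  · have h1 := squeeze_zero_norm hq' h0
    simpa using h1.add ((Complex.continuous_exp.tendsto a).comp hp')

theorem isOpen_halfPlane (θ : ℝ) : IsOpen (halfPlane θ) :=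
  isOpen_lt continuous_const Complex.continuous_re

theorem IsUniformLimit.differentiableOn {g : ℂ → ℂ} {a : ℂ} (hg : IsUniformLimit g a) {ε : ℝ}
    (hε : 0 < ε) : DifferentiableOn ℂ g (halfPlane ε) := by
  obtain ⟨p, hp, -⟩ := hg
  exact (hp ε hε).tendstoLocallyUniformlyOn.differentiableOn
    (Eventually.of_forall fun N => (differentiable_evalAt (p N)).differentiableOn)
    (isOpen_halfPlane ε)

theorem vertical_mem_halfPlane {σ θ : ℝ} (h : θ < σ) (t : ℝ) :
    (σ + t * Complex.I : ℂ) ∈ halfPlane θ := by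
  simpa [halfPlane] using h

theorem TendstoUniformlyOn.vertical {E : Type*} [PseudoMetricSpace E] {q : ℕ → ℂ → E} {g : ℂ → E}
    {σ : ℝ} (hq : TendstoUniformlyOn q g atTop (halfPlane (σ / 2))) (hσ : 0 < σ) :
    TendstoUniformly (fun N (t : ℝ) => q N (σ + t * Complex.I)) (fun t => g (σ + t * Complex.I))
      atTop := by
  rw [Metric.tendstoUniformlyOn_iff] at hq
  rw [Metric.tendstoUniformly_iff]
  intro ε hε
  filter_upwards [hq ε hε] with N hN t
  exact hN _ (vertical_mem_halfPlane (by linarith) t)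

theorem IsUniformLimit.hasMean {g : ℂ → ℂ} {a : ℂ} (hg : IsUniformLimit g a) {σ : ℝ}
    (hσ : 0 < σ) : HasMean (fun t : ℝ => g (σ + t * Complex.I)) a := by
  obtain ⟨p, hp, hp'⟩ := hg
  exact HasMean.of_tendstoUniformly (fun N => hasMean_evalAt σ (p N))
    (TendstoUniformlyOn.vertical (hp (σ / 2) (half_pos hσ)) hσ) hp'

/-- By Carlson's theorem the squared Hardy norm is a vertical mean, so a supremum bound dominates
it. This turns uniform convergence into convergence in the Hardy space. -/
theorem norm_shift_le {σ η : ℝ} (hσ : 0 < σ) (hη : 0 ≤ η) (p : DirichletPoly)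
    (hp : ∀ s ∈ halfPlane (σ / 2), ‖evalAt s p‖ ≤ η) : ‖shift σ p‖ ≤ η := by
  refine (sq_le_sq₀ (norm_nonneg _) hη).1 ?_
  refine (hasMean_normSq_evalAt σ p).mono (hasMean_const (η ^ 2)) fun t => ?_
  gcongr
  exact hp _ (vertical_mem_halfPlane (by linarith) t)

/-- The coefficients of a uniform limit of Dirichlet polynomials on the line `Re s = σ`. -/
theorem exists_tendsto_shift {p : ℕ → DirichletPoly} {g : ℂ → ℂ} {σ : ℝ} (hσ : 0 < σ)
    (hp : TendstoUniformlyOn (fun N s => evalAt s (p N)) g atTop (halfPlane (σ / 2))) :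
    ∃ q : HardySpace, Tendsto (fun N => shift σ (p N)) atTop (𝓝 q) ∧
      HasMean (fun t : ℝ => ‖g (σ + t * Complex.I)‖ ^ 2) (‖q‖ ^ 2) ∧
      ∀ s ∈ halfPlane (1 / 2), eval q s = g (s + σ) := by
  have hc : CauchySeq fun N => shift σ (p N) := by
    rw [Metric.cauchySeq_iff]
    intro ε hε
    have h1 := Metric.tendstoUniformlyOn_iff.1 hp (ε / 3) (by positivity)
    obtain ⟨N, hN⟩ := eventually_atTop.1 h1
    refine ⟨N, fun m hm n hn => ?_⟩
    rw [dist_eq_norm, ← map_sub]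
    refine lt_of_le_of_lt (norm_shift_le hσ (η := ε / 3 + ε / 3) (by positivity) _
      fun s hs => ?_) (by linarith)
    rw [map_sub, ← dist_eq_norm]
    exact (dist_triangle_left _ _ (g s)).trans (add_le_add (hN m hm s hs).le (hN n hn s hs).le)
  obtain ⟨q, hq⟩ := cauchySeq_tendsto_of_complete hc
  obtain ⟨B, hB⟩ := exists_bound_of_tendstoUniformlyOn (half_pos hσ) hp
  refine ⟨q, hq, ?_, fun s hs => ?_⟩
  · exact HasMean.of_tendstoUniformly (fun N => hasMean_normSq_evalAt σ (p N))
      (TendstoUniformlyOn.vertical (TendstoUniformlyOn.comp_of_bounded hp hB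
        (F := fun z => ‖z‖ ^ 2) (by fun_prop)) hσ)
      (hq.norm.pow 2)
  · have h1 : Tendsto (fun N => eval (shift σ (p N)) s) atTop (𝓝 (eval q s)) :=
      ((continuous_eval hs).tendsto q).comp hq
    have hs' : s + σ ∈ halfPlane (σ / 2) := by
      have : (1 : ℝ) / 2 < s.re := hs
      simp only [halfPlane, mem_ofPred_eq, Complex.add_re, Complex.ofReal_re]
      linarith
    simp only [eval_shift σ _ hs] at h1
    exact tendsto_nhds_unique h1 (hp.tendsto_at hs')

/-- A uniform limit of Dirichlet polynomials whose modulus squared has a majorant with bounded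
vertical means belongs to the Hardy space. -/
theorem IsUniformLimit.exists_eval_eq {g : ℂ → ℂ} {a : ℂ} (hg : IsUniformLimit g a)
    {U : ℂ → ℝ} {κ : ℝ} (hU : ∀ σ : ℝ, 0 < σ → HasMean (fun t : ℝ => U (σ + t * Complex.I)) κ)
    (hgU : ∀ s ∈ halfPlane 0, ‖g s‖ ^ 2 ≤ U s) :
    ∃ b : HardySpace, ‖b‖ ^ 2 ≤ κ ∧ ∀ s ∈ halfPlane (1 / 2), eval b s = g s := by
  obtain ⟨p, hp, -⟩ := hg
  choose! q hq hqm hqe using fun σ : ℝ => fun hσ : 0 < σ =>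
    exists_tendsto_shift hσ (hp (σ / 2) (half_pos hσ))
  have hqκ : ∀ σ : ℝ, 0 < σ → ‖q σ‖ ^ 2 ≤ κ := fun σ hσ =>
    (hqm σ hσ).mono (hU σ hσ) fun t => hgU _ (vertical_mem_halfPlane hσ t)
  have hκ : 0 ≤ κ := (sq_nonneg _).trans (hqκ 1 one_pos)
  have hn0 : ∀ n : ℕ+, (n : ℂ) ≠ 0 := fun n => by exact_mod_cast n.ne_zero
  have hcoord : ∀ n : ℕ+, Continuous fun f : HardySpace => f n := fun n =>
    (continuous_apply n).comp lp.uniformContinuous_coe.continuous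
  -- The limit of the n-th coefficients does not involve σ, so all the `q σ` are horizontal
  -- translates of one coefficient sequence.
  have hcoeff : ∀ σ : ℝ, 0 < σ → ∀ n : ℕ+,
      Tendsto (fun N => (p N).coeff n) atTop (𝓝 (q σ n * (n : ℂ) ^ (σ : ℂ))) := by
    intro σ hσ n
    have h1 := (((hcoord n).tendsto _).comp (hq σ hσ)).mul_const ((n : ℂ) ^ (σ : ℂ))
    refine h1.congr fun N => ?_
    simp only [Function.comp, shift_apply]
    rw [mul_assoc, ← Complex.cpow_add _ _ (hn0 n)]
    simp
  -- Any positive σ would define the same sequence; σ = 1 is a convenient choice.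
  set b : ℕ+ → ℂ := fun n => q 1 n * (n : ℂ) ^ ((1 : ℝ) : ℂ) with hb
  have hqb : ∀ σ : ℝ, 0 < σ → ∀ n, q σ n = b n * (n : ℂ) ^ (-(σ : ℂ)) := by
    intro σ hσ n
    rw [tendsto_nhds_unique (hcoeff 1 one_pos n) (hcoeff σ hσ n) |> fun h => (show b n = _ from h),
      mul_assoc, ← Complex.cpow_add _ _ (hn0 n)]
    simp
  -- A Fatou argument: the bound κ holds for every σ > 0, and in a finite sum σ may tend to 0.
  have hsum : ∀ S : Finset ℕ+, ∑ n ∈ S, ‖b n‖ ^ 2 ≤ κ := by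
    intro S
    have h1 : ∀ᶠ σ : ℝ in 𝓝[>] 0, ∑ n ∈ S, ‖b n * (n : ℂ) ^ (-(σ : ℂ))‖ ^ 2 ≤ κ := by
      filter_upwards [self_mem_nhdsWithin] with σ hσ
      have h2 := lp.sum_rpow_le_norm_rpow (p := 2) (by norm_num) (q σ) S
      simp only [ENNReal.toReal_ofNat, Real.rpow_ofNat] at h2
      simp only [← hqb σ hσ]
      exact h2.trans (hqκ σ hσ)
    have h3 : Tendsto (fun σ : ℝ => ∑ n ∈ S, ‖b n * (n : ℂ) ^ (-(σ : ℂ))‖ ^ 2) (𝓝[>] 0)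
        (𝓝 (∑ n ∈ S, ‖b n‖ ^ 2)) := by
      have h4 : Continuous fun σ : ℝ => ∑ n ∈ S, ‖b n * (n : ℂ) ^ (-(σ : ℂ))‖ ^ 2 := by
        refine continuous_finsetSum _ fun n _ => ((continuous_const.mul ?_).norm).pow 2
        exact (Complex.continuous_ofReal.neg).const_cpow (Or.inl (hn0 n))
      simpa using (h4.tendsto 0).mono_left nhdsWithin_le_nhds
    exact le_of_tendsto h3 h1
  have hbm : Memℓp b 2 := memℓp_gen' (C := κ) fun S => by
    simpa using hsum S
  refine ⟨⟨b, hbm⟩, ?_, fun s hs => ?_⟩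
  · have h1 := lp.norm_le_of_forall_sum_le (p := 2) (by norm_num) (Real.sqrt_nonneg κ)
      (f := (⟨b, hbm⟩ : HardySpace)) fun S => by
        simpa [Real.sq_sqrt hκ] using hsum S
    calc _ ≤ √κ ^ 2 := by gcongr
      _ = κ := Real.sq_sqrt hκ
  · have hs' : (1 : ℝ) / 2 < s.re := hs
    -- Half the distance to the line Re = 1/2, so that s - σ is still in the half-plane.
    set σ : ℝ := (s.re - 1 / 2) / 2 with hσ
    have hσ0 : 0 < σ := by
      rw [hσ]
      linarith
    have h1 := hqe σ hσ0 (s - σ) (by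
      simp only [halfPlane, mem_ofPred_eq, Complex.sub_re, Complex.ofReal_re]
      linarith)
    rw [sub_add_cancel] at h1
    rw [← h1, eval, eval]
    refine tsum_congr fun n => ?_
    rw [hqb σ hσ0, mul_assoc (b n), ← Complex.cpow_add _ _ (hn0 n)]
    congr 2
    ring

theorem eval_zero (s : ℂ) : eval 0 s = 0 := by
  simp [eval]

/-- The constant term of a uniform limit of Dirichlet polynomials which maps the right half-plane
to `Re s > 1/2` lies in `Re s > 1/2`. -/
theorem IsUniformLimit.half_lt_re {φ : ℂ → ℂ} {c : ℂ} (hφ : IsUniformLimit φ c)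
    (hm : MapsTo φ (halfPlane 0) (halfPlane (1 / 2))) : 1 / 2 < c.re := by
  by_contra! hc
  -- The function G = exp(1/2 - φ) has modulus below 1, yet its constant term γ would have modulus
  -- at least 1. Then |G - γ|² is at most 1 + |γ|² - 2 Re(conj γ · G), whose mean is 1 - |γ|² ≤ 0.
  -- Hence G = γ on Re s > 1/2, which is absurd.
  set γ : ℂ := Complex.exp ((-1) * (c - 1 / 2)) with hγ
  have hg : IsUniformLimit (fun s => Complex.exp ((-1) * (φ s - 1 / 2))) γ :=
    ((hφ.sub (isUniformLimit_const (1 / 2))).const_mul (-1)).exp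
  have hnorm : ∀ w : ℂ, ‖Complex.exp ((-1) * (w - 1 / 2))‖ = Real.exp (1 / 2 - w.re) := by
    intro w
    rw [Complex.norm_exp]
    congr 1
    simp
  have hg1 : ∀ s ∈ halfPlane 0, ‖Complex.exp ((-1) * (φ s - 1 / 2))‖ < 1 := by
    intro s hs
    have : (1 : ℝ) / 2 < (φ s).re := hm hs
    rw [hnorm, Real.exp_lt_one_iff]
    linarith
  have hγ1 : 1 ≤ ‖γ‖ := by
    rw [hγ, hnorm, Real.one_le_exp_iff]
    linarith
  obtain ⟨b, hb, hbe⟩ := (hg.sub (isUniformLimit_const γ)).exists_eval_eq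
    (U := fun s => 1 + ‖γ‖ ^ 2 +
      (-2) * ((starRingEnd ℂ) γ * Complex.exp ((-1) * (φ s - 1 / 2))).re)
    (κ := 1 + ‖γ‖ ^ 2 + (-2) * ((starRingEnd ℂ) γ * γ).re)
    (fun σ hσ => (hasMean_const _).add (((hg.hasMean hσ).const_mul _).re.real_const_mul _))
    (fun s hs => by
      set G := Complex.exp ((-1) * (φ s - 1 / 2))
      have h1 : ‖G‖ ^ 2 ≤ 1 := by
        have := hg1 s hs
        have := norm_nonneg G
        nlinarith
      have h2 : ‖G - γ‖ ^ 2 = ‖G‖ ^ 2 + ‖γ‖ ^ 2 - 2 * ((starRingEnd ℂ) γ * G).re := by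
        simp only [← Complex.normSq_eq_norm_sq, Complex.normSq_apply, Complex.sub_re,
          Complex.sub_im, Complex.mul_re, Complex.conj_re, Complex.conj_im]
        ring
      linarith)
  have hb0 : b = 0 := by
    have h1 : ((starRingEnd ℂ) γ * γ).re = ‖γ‖ ^ 2 := by
      rw [Complex.conj_mul', ← Complex.ofReal_pow, Complex.ofReal_re]
    rw [h1] at hb
    have h2 : ‖b‖ ^ 2 = 0 := le_antisymm (by nlinarith) (sq_nonneg _)
    simpa using h2
  have h1 : (1 : ℂ) ∈ halfPlane (1 / 2) := by
    norm_num [halfPlane]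
  have h2 := hbe 1 h1
  rw [hb0, eval_zero] at h2
  have h3 := hg1 1 (halfPlane_subset (by norm_num) h1)
  rw [← sub_eq_zero.1 h2.symm] at hγ1
  linarith

/-! ### A harmonic majorant of the modulus squared -/

/-- Abel summation, with the increments of `E` set against the tails of `z`. -/
theorem sum_mul_sub_eq_sum_sub_mul_tail (z E : ℕ → ℂ) (N : ℕ) :
    ∑ j ∈ Finset.range N, z j * (E (j + 1) - E 0) =
      ∑ k ∈ Finset.range N, (E (k + 1) - E k) * ∑ j ∈ Finset.Ico k N, z j := by
  simp only [Finset.mul_sum, Finset.range_eq_Ico]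
  rw [Finset.sum_Ico_Ico_comm]
  refine Finset.sum_congr rfl fun j _ => ?_
  rw [← Finset.sum_mul, ← Finset.range_eq_Ico, Finset.sum_range_sub, mul_comm]

/-- Expanding the squares, the pair (i, j) occurs in the tails with k ≤ min(i, j), and the weights
telescope over this range. -/
theorem sum_sub_mul_norm_tail_sq (z : ℕ → ℂ) (y : ℕ → ℝ) (hy : y 0 = 0) (N : ℕ) :
    ∑ k ∈ Finset.range N, (y (k + 1) - y k) * ‖∑ j ∈ Finset.Ico k N, z j‖ ^ 2 =
      ∑ i ∈ Finset.range N, ∑ j ∈ Finset.range N,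
        (z i * (starRingEnd ℂ) (z j)).re * y (min i j + 1) := by
  have h1 : ∀ k, ‖∑ j ∈ Finset.Ico k N, z j‖ ^ 2 = ∑ i ∈ Finset.range N, ∑ j ∈ Finset.range N,
      if k ≤ min i j then (z i * (starRingEnd ℂ) (z j)).re else 0 := by
    intro k
    have h2 : ∑ j ∈ Finset.Ico k N, z j = ∑ j ∈ Finset.range N, if k ≤ j then z j else 0 := by
      rw [← Finset.sum_filter]
      refine Finset.sum_congr ?_ fun _ _ => rfl
      ext j
      simp [and_comm]
    have h3 : ‖∑ j ∈ Finset.Ico k N, z j‖ ^ 2 =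
        ((∑ j ∈ Finset.Ico k N, z j) * (starRingEnd ℂ) (∑ j ∈ Finset.Ico k N, z j)).re := by
      rw [Complex.mul_conj', ← Complex.ofReal_pow, Complex.ofReal_re]
    rw [h3, h2, map_sum, Finset.sum_mul_sum, Complex.re_sum]
    refine Finset.sum_congr rfl fun i _ => ?_
    rw [Complex.re_sum]
    refine Finset.sum_congr rfl fun j _ => ?_
    by_cases hi : k ≤ i <;> by_cases hj : k ≤ j <;> simp [hi, hj]
  simp only [h1, Finset.mul_sum]
  rw [Finset.sum_comm]
  refine Finset.sum_congr rfl fun i hi => ?_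
  rw [Finset.sum_comm]
  refine Finset.sum_congr rfl fun j hj => ?_
  have h4 : (Finset.range N).filter (fun k => k ≤ min i j) = Finset.range (min i j + 1) := by
    ext k
    simp only [Finset.mem_filter, Finset.mem_range] at hi hj ⊢
    omega
  simp only [mul_ite, mul_zero]
  rw [← Finset.sum_filter, h4, ← Finset.sum_mul, Finset.sum_range_sub, hy]
  ring

/-- The terms of a Dirichlet series, the coefficient of `(j + 1)^{-w}` being `a j`. -/
def dterm (a : ℕ → ℂ) (w : ℂ) (j : ℕ) : ℂ := a j * ((j + 1 : ℕ) : ℂ) ^ (-w)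

/-- The harmonic majorant of the modulus squared of a Dirichlet polynomial, see
`norm_sum_dterm_sq_le`. It is the real part of an exponential sum, see `majorant_eq`. -/
def majorant (a : ℕ → ℂ) (N : ℕ) (w : ℂ) : ℝ :=
  ∑ k ∈ Finset.range N, (((k + 1 : ℕ) : ℝ) ^ (2 * w.re - 1) - (k : ℝ) ^ (2 * w.re - 1)) *
    ‖∑ j ∈ Finset.Ico k N, dterm a w j‖ ^ 2

theorem rpow_succ_sub_nonneg (k : ℕ) {x : ℝ} (hx : 0 ≤ x) :
    0 ≤ ((k + 1 : ℕ) : ℝ) ^ x - (k : ℝ) ^ x := by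
  rw [sub_nonneg]
  gcongr
  simp

theorem majorant_nonneg (a : ℕ → ℂ) (N : ℕ) {w : ℂ} (hw : w ∈ halfPlane (1 / 2)) :
    0 ≤ majorant a N w := by
  have hw' : 1 / 2 < w.re := hw
  exact Finset.sum_nonneg fun k _ =>
    mul_nonneg (rpow_succ_sub_nonneg k (by linarith)) (sq_nonneg _)

theorem majorant_eq_sum (a : ℕ → ℂ) (N : ℕ) {w : ℂ} (hw : w ∈ halfPlane (1 / 2)) :
    majorant a N w = ∑ i ∈ Finset.range N, ∑ j ∈ Finset.range N,
      (dterm a w i * (starRingEnd ℂ) (dterm a w j)).re *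
        ((min i j + 1 : ℕ) : ℝ) ^ (2 * w.re - 1) := by
  have hw' : 1 / 2 < w.re := hw
  refine sum_sub_mul_norm_tail_sq (dterm a w) (fun k => (k : ℝ) ^ (2 * w.re - 1)) ?_ N
  simp only [Nat.cast_zero]
  exact Real.zero_rpow (by linarith)

/-- The exponential whose real part enters the majorant. -/
def pairExp (i j : ℕ) (w : ℂ) : ℂ :=
  Complex.exp ((Real.log (j + 1 : ℕ) - Real.log (i + 1 : ℕ) : ℝ) * w + (-Real.log (j + 1 : ℕ) : ℝ))

/-- The source of harmonicity: with m = j + 1, the conjugate of m^{-w} times m^{2 Re w - 1} equals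
m^{w - 1}, which is holomorphic in w. -/
theorem dterm_mul_conj_mul (a : ℕ → ℂ) (w : ℂ) (i j : ℕ) :
    dterm a w i * (starRingEnd ℂ) (dterm a w j) * (((j + 1 : ℕ) : ℝ) ^ (2 * w.re - 1) : ℝ) =
      a i * (starRingEnd ℂ) (a j) * pairExp i j w := by
  have hn0 : ∀ k : ℕ, ((k + 1 : ℕ) : ℂ) ≠ 0 := fun k => by exact_mod_cast k.succ_ne_zero
  have hlog : ∀ k : ℕ, Complex.log ((k + 1 : ℕ) : ℂ) = (Real.log (k + 1 : ℕ) : ℝ) := fun k => by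
    rw [Complex.natCast_log]
  have hre : ((2 * w.re : ℝ) : ℂ) = w + (starRingEnd ℂ) w := (Complex.add_conj w).symm
  have he : Complex.exp ((Real.log (i + 1 : ℕ) : ℝ) * -w) *
      Complex.exp ((Real.log (j + 1 : ℕ) : ℝ) * -(starRingEnd ℂ) w) *
      Complex.exp ((Real.log (j + 1 : ℕ) * (2 * w.re - 1) : ℝ)) = pairExp i j w := by
    rw [pairExp, ← Complex.exp_add, ← Complex.exp_add]
    congr 1
    rw [Complex.ofReal_mul, Complex.ofReal_sub, hre]
    push_cast
    ring
  rw [dterm, dterm, Complex.cpow_def_of_ne_zero (hn0 i), Complex.cpow_def_of_ne_zero (hn0 j), hlog,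
    hlog, map_mul, ← Complex.exp_conj, map_mul, map_neg, Complex.conj_ofReal,
    Real.rpow_def_of_pos (by positivity), Complex.ofReal_exp, ← he]
  ring

theorem majorant_eq (a : ℕ → ℂ) (N : ℕ) {w : ℂ} (hw : w ∈ halfPlane (1 / 2)) :
    majorant a N w = (∑ i ∈ Finset.range N, ∑ j ∈ Finset.range N,
      a (max i j) * (starRingEnd ℂ) (a (min i j)) * pairExp (max i j) (min i j) w).re := by
  rw [majorant_eq_sum a N hw, Complex.re_sum]
  refine Finset.sum_congr rfl fun i _ => ?_
  rw [Complex.re_sum]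
  refine Finset.sum_congr rfl fun j _ => ?_
  rw [← dterm_mul_conj_mul, Complex.re_mul_ofReal]
  congr 1
  rcases le_total i j with h | h
  · rw [max_eq_right h, min_eq_left h, ← Complex.conj_re, map_mul, Complex.conj_conj, mul_comm]
  · rw [max_eq_left h, min_eq_right h]

theorem norm_sum_dterm_sq_le (a : ℕ → ℂ) (N : ℕ) {w : ℂ} (hw : w ∈ halfPlane (1 / 2)) :
    ‖∑ j ∈ Finset.range N, dterm a w j‖ ^ 2 ≤ majorant a N w := by
  have hw' : 1 / 2 < w.re := hw
  rcases Nat.eq_zero_or_pos N with rfl | hN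
  · simp [majorant]
  have h1 := Finset.single_le_sum (f := fun k => (((k + 1 : ℕ) : ℝ) ^ (2 * w.re - 1) -
    (k : ℝ) ^ (2 * w.re - 1)) * ‖∑ j ∈ Finset.Ico k N, dterm a w j‖ ^ 2)
    (fun k _ => mul_nonneg (rpow_succ_sub_nonneg k (by linarith)) (sq_nonneg _))
    (Finset.mem_range.2 hN)
  -- The exponent is positive, so the term k = 0 has weight 1 and is exactly the left-hand side.
  have h2 : (0 : ℝ) ^ (2 * w.re - 1) = 0 := Real.zero_rpow (by linarith)
  refine le_trans (le_of_eq ?_) h1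
  simp [h2]

/-- Mean value inequality for r ↦ exp(-rδ) on [log k, log(k+1)], where the derivative is at most |δ|
in modulus because Re δ ≥ 0. -/
theorem norm_cpow_succ_sub_le {δ : ℂ} (hδ : 0 ≤ δ.re) {k : ℕ} (hk : 1 ≤ k) :
    ‖((k + 1 : ℕ) : ℂ) ^ (-δ) - (k : ℂ) ^ (-δ)‖ ≤
      ‖δ‖ * (Real.log (k + 1 : ℕ) - Real.log k) := by
  have hder : ∀ r : ℝ, HasDerivAt (fun r : ℝ => Complex.exp (r * -δ)) (Complex.exp (r * -δ) * -δ) r :=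
    fun r => by
      have h1 : HasDerivAt (fun r : ℝ => (r : ℂ) * -δ) (-δ) r := by
        simpa using (Complex.ofRealCLM.hasDerivAt (x := r)).mul_const (-δ)
      exact h1.cexp
  have hk0 : 0 ≤ Real.log k := Real.log_natCast_nonneg k
  have hle : Real.log k ≤ Real.log (k + 1 : ℕ) :=
    Real.log_le_log (by positivity) (by exact_mod_cast k.le_succ)
  have h2 := norm_image_sub_le_of_norm_deriv_le_segment' (C := ‖δ‖)
    (fun r _ => (hder r).hasDerivWithinAt (s := Icc (Real.log k) (Real.log (k + 1 : ℕ))))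
    (fun r hr => by
      rw [norm_mul, norm_neg, Complex.norm_exp]
      refine mul_le_of_le_one_left (norm_nonneg _) (Real.exp_le_one_iff.2 ?_)
      have h3 : 0 ≤ r := hk0.trans hr.1
      simp only [Complex.mul_re, Complex.ofReal_re, Complex.neg_re, Complex.ofReal_im, zero_mul,
        sub_zero]
      nlinarith [mul_nonneg h3 hδ]) _ (right_mem_Icc.2 hle)
  have hc : ∀ n : ℕ, n ≠ 0 → (n : ℂ) ^ (-δ) = Complex.exp ((Real.log n : ℝ) * -δ) := fun n hn => by
    rw [Complex.cpow_def_of_ne_zero (by exact_mod_cast hn), Complex.natCast_log]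
  rw [hc _ k.succ_ne_zero, hc k (by omega)]
  exact h2

/-- The right-hand side is (2 sinh(y/2))², and |sinh u| ≥ |u|. -/
theorem sq_le_exp_sub_one_mul (y : ℝ) : y ^ 2 ≤ (Real.exp y - 1) * (1 - Real.exp (-y)) := by
  have h1 : (Real.exp y - 1) * (1 - Real.exp (-y)) = (2 * Real.sinh (y / 2)) ^ 2 := by
    rw [Real.sinh_eq]
    have h2 : Real.exp y = Real.exp (y / 2) ^ 2 := by
      rw [← Real.exp_nat_mul]
      congr 1
      push_cast
      ring
    have h3 : Real.exp (-y) = Real.exp (-(y / 2)) ^ 2 := by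
      rw [← Real.exp_nat_mul]
      congr 1
      push_cast
      ring
    have h4 : Real.exp (y / 2) * Real.exp (-(y / 2)) = 1 := by
      rw [← Real.exp_add]
      simp
    rw [h2, h3]
    linear_combination (1 - Real.exp (y / 2) * Real.exp (-(y / 2))) * h4
  rw [h1, sq_le_sq, abs_mul, abs_two]
  rcases le_total 0 y with h | h
  · have := Real.self_le_sinh_iff.2 (by linarith : 0 ≤ y / 2)
    rw [abs_of_nonneg h, abs_of_nonneg (by linarith)]
    linarith
  · have := Real.sinh_le_self_iff.2 (by linarith : y / 2 ≤ 0)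
    rw [abs_of_nonpos h, abs_of_nonpos (by linarith)]
    linarith

/-- Splits the squared increment for Cauchy-Schwarz: the first factor is the weight of the majorant,
the second telescopes. It is the preceding inequality at y = x log((k+1)/k). -/
theorem log_succ_sub_sq_le {k : ℕ} (hk : 1 ≤ k) (x : ℝ) :
    (x * (Real.log (k + 1 : ℕ) - Real.log k)) ^ 2 ≤
      (((k + 1 : ℕ) : ℝ) ^ x - (k : ℝ) ^ x) * ((k : ℝ) ^ (-x) - ((k + 1 : ℕ) : ℝ) ^ (-x)) := by
  have hk0 : (0 : ℝ) < k := by exact_mod_cast hk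
  have hk1 : (0 : ℝ) < (k + 1 : ℕ) := by positivity
  refine (sq_le_exp_sub_one_mul _).trans (le_of_eq ?_)
  rw [Real.rpow_def_of_pos hk0, Real.rpow_def_of_pos hk1, Real.rpow_def_of_pos hk0,
    Real.rpow_def_of_pos hk1]
  set p := Real.log (k + 1 : ℕ)
  set q := Real.log k
  have e1 : Real.exp (x * (p - q)) = Real.exp (p * x) * Real.exp (q * -x) := by
    rw [← Real.exp_add]
    congr 1
    ring
  have e2 : Real.exp (-(x * (p - q))) = Real.exp (q * x) * Real.exp (p * -x) := by
    rw [← Real.exp_add]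
    congr 1
    ring
  have e3 : ∀ t, Real.exp (t * x) * Real.exp (t * -x) = 1 := fun t => by
    rw [← Real.exp_add]
    simp
  rw [e1, e2]
  linear_combination (1 - Real.exp (p * x) * Real.exp (p * -x)) * e3 q + (0 : ℝ) * e3 p

/-- Passing from w to v multiplies the n-th term by n^{-δ}. Abel summation expresses the difference
through the tails at w, and Cauchy-Schwarz separates the majorant from a telescoping sum that is at
most 1. -/
theorem norm_sum_dterm_sub_sq_le_of_re_le (a : ℕ → ℂ) (N : ℕ) {w v : ℂ}
    (hw : w ∈ halfPlane (1 / 2)) (hwv : w.re ≤ v.re) :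
    (2 * w.re - 1) ^ 2 *
      ‖∑ j ∈ Finset.range N, dterm a v j - ∑ j ∈ Finset.range N, dterm a w j‖ ^ 2 ≤
      ‖v - w‖ ^ 2 * majorant a N w := by
  have hw' : 1 / 2 < w.re := hw
  set x : ℝ := 2 * w.re - 1 with hx
  have hx0 : 0 < x := by
    rw [hx]
    linarith
  set δ : ℂ := v - w with hδ
  have hδ0 : 0 ≤ δ.re := by simpa [hδ] using hwv
  -- Replacing k by max(k, 1) gives `E 0 = E 1 = 1` and `G 0 = G 1 = 1`: the base value is 1 and the
  -- increments at k = 0 vanish.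
  set E : ℕ → ℂ := fun k => ((max k 1 : ℕ) : ℂ) ^ (-δ) with hE
  set G : ℕ → ℝ := fun k => ((max k 1 : ℕ) : ℝ) ^ (-x) with hG
  have h1 : ∑ j ∈ Finset.range N, dterm a v j - ∑ j ∈ Finset.range N, dterm a w j =
      ∑ k ∈ Finset.range N, (E (k + 1) - E k) * ∑ j ∈ Finset.Ico k N, dterm a w j := by
    rw [← sum_mul_sub_eq_sum_sub_mul_tail, ← Finset.sum_sub_distrib]
    refine Finset.sum_congr rfl fun j _ => ?_
    have hj : ((j + 1 : ℕ) : ℂ) ≠ 0 := by exact_mod_cast j.succ_ne_zero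
    have h2 : E (j + 1) = ((j + 1 : ℕ) : ℂ) ^ (-δ) := by
      simp only [hE]
      rw [max_eq_left (by omega)]
    have h3 : E 0 = 1 := by simp [hE]
    rw [h2, h3, dterm, dterm, mul_sub, mul_assoc, ← Complex.cpow_add _ _ hj, hδ]
    ring_nf
  have hd : ∀ k : ℕ, (x * ‖E (k + 1) - E k‖) ^ 2 ≤
      ‖δ‖ ^ 2 * ((((k + 1 : ℕ) : ℝ) ^ x - (k : ℝ) ^ x) * (G k - G (k + 1))) := by
    intro k
    rcases Nat.eq_zero_or_pos k with rfl | hk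
    · simp [hE, hG]
    · have h4 : max k 1 = k := max_eq_left hk
      have h5 : max (k + 1) 1 = k + 1 := max_eq_left (by omega)
      simp only [hE, hG, h4, h5]
      have h6 := norm_cpow_succ_sub_le hδ0 hk
      calc _ ≤ (x * (‖δ‖ * (Real.log (k + 1 : ℕ) - Real.log k))) ^ 2 := by gcongr
        _ = ‖δ‖ ^ 2 * (x * (Real.log (k + 1 : ℕ) - Real.log k)) ^ 2 := by ring
        _ ≤ _ := by
          gcongr
          exact log_succ_sub_sq_le hk x
  have hGanti : ∀ k, 0 ≤ G k - G (k + 1) := fun k => by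
    simp only [hG, sub_nonneg]
    refine Real.rpow_le_rpow_of_nonpos (by positivity) ?_ (by linarith)
    exact_mod_cast max_le_max_right 1 k.le_succ
  have hGsum : ∑ k ∈ Finset.range N, (G k - G (k + 1)) ≤ 1 := by
    rw [Finset.sum_range_sub']
    have h6 : G 0 = 1 := by simp [hG]
    have h7 : 0 ≤ G N := by positivity
    linarith
  have hCS : (∑ k ∈ Finset.range N, x * (‖E (k + 1) - E k‖ *
      ‖∑ j ∈ Finset.Ico k N, dterm a w j‖)) ^ 2 ≤
      (∑ k ∈ Finset.range N, (G k - G (k + 1))) * (∑ k ∈ Finset.range N, ‖δ‖ ^ 2 *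
        ((((k + 1 : ℕ) : ℝ) ^ x - (k : ℝ) ^ x) * ‖∑ j ∈ Finset.Ico k N, dterm a w j‖ ^ 2)) := by
    refine Finset.sum_sq_le_sum_mul_sum_of_sq_le_mul _ (fun k _ => hGanti k)
      (fun k _ => mul_nonneg (sq_nonneg _)
        (mul_nonneg (rpow_succ_sub_nonneg k hx0.le) (sq_nonneg _))) fun k _ => ?_
    have := mul_le_mul_of_nonneg_right (hd k) (sq_nonneg ‖∑ j ∈ Finset.Ico k N, dterm a w j‖)
    nlinarith [this]
  have hnorm : x * ‖∑ j ∈ Finset.range N, dterm a v j - ∑ j ∈ Finset.range N, dterm a w j‖ ≤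
      ∑ k ∈ Finset.range N, x * (‖E (k + 1) - E k‖ *
        ‖∑ j ∈ Finset.Ico k N, dterm a w j‖) := by
    rw [h1, ← Finset.mul_sum]
    gcongr
    exact norm_sum_le_of_le _ fun k _ => (norm_mul _ _).le
  rw [← Finset.mul_sum (f := fun k : ℕ => (((k + 1 : ℕ) : ℝ) ^ x - (k : ℝ) ^ x) *
    ‖∑ j ∈ Finset.Ico k N, dterm a w j‖ ^ 2)] at hCS
  have hmaj : 0 ≤ ‖δ‖ ^ 2 * majorant a N w := mul_nonneg (sq_nonneg _) (majorant_nonneg a N hw)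
  calc _ = (x * ‖∑ j ∈ Finset.range N, dterm a v j - ∑ j ∈ Finset.range N, dterm a w j‖) ^ 2 := by
        ring
    _ ≤ _ := pow_le_pow_left₀ (by positivity) hnorm 2
    _ ≤ _ := hCS
    _ ≤ 1 * (‖δ‖ ^ 2 * majorant a N w) := mul_le_mul_of_nonneg_right hGsum hmaj
    _ = _ := one_mul _

/-- The point with smaller real part serves as base point; the sum of both majorants covers either
case. -/
theorem norm_sum_dterm_sub_sq_le (a : ℕ → ℂ) (N : ℕ) {w v : ℂ} {x : ℝ} (hx : 0 < x)
    (hw : 1 / 2 + x ≤ w.re) (hv : 1 / 2 + x ≤ v.re) :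
    (2 * x) ^ 2 * ‖∑ j ∈ Finset.range N, dterm a v j - ∑ j ∈ Finset.range N, dterm a w j‖ ^ 2 ≤
      ‖v - w‖ ^ 2 * (majorant a N w + majorant a N v) := by
  have hw' : w ∈ halfPlane (1 / 2) := show 1 / 2 < w.re by linarith
  have hv' : v ∈ halfPlane (1 / 2) := show 1 / 2 < v.re by linarith
  have hMw := majorant_nonneg a N hw'
  have hMv := majorant_nonneg a N hv'
  rcases le_total w.re v.re with h | h
  · calc _ ≤ (2 * w.re - 1) ^ 2 * _ := by
          gcongr
          linarith
      _ ≤ _ := norm_sum_dterm_sub_sq_le_of_re_le a N hw' h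
      _ ≤ _ := by
        gcongr
        linarith
  · rw [norm_sub_rev, norm_sub_rev v]
    calc _ ≤ (2 * v.re - 1) ^ 2 * _ := by
          gcongr
          linarith
      _ ≤ _ := norm_sum_dterm_sub_sq_le_of_re_le a N hv' h
      _ ≤ _ := by
        gcongr
        linarith

/-! ### An upper bound for the majorant -/

/-- Bernoulli's inequality (1 - 1/t)^x ≤ 1 - x/t for exponents in (0, 1]. It replaces an integral
comparison by a telescoping bound. -/
theorem mul_rpow_sub_one_le {x t : ℝ} (hx : 0 < x) (hx1 : x ≤ 1) (ht : 1 ≤ t) :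
    x * t ^ (x - 1) ≤ t ^ x - (t - 1) ^ x := by
  have h0 : 0 < t := by linarith
  have h1 := _root_.rpow_one_add_le_one_add_mul_self (s := -(1 / t))
    (by rw [neg_le_neg_iff, div_le_one h0]; exact ht) hx.le hx1
  have h2 : t - 1 = t * (1 + -(1 / t)) := by
    field_simp
    ring
  have h3 : 0 ≤ 1 + -(1 / t) := by
    have : 1 / t ≤ 1 := (div_le_one h0).2 ht
    linarith
  rw [h2, Real.mul_rpow h0.le h3, Real.rpow_sub_one h0.ne']
  have h4 : 0 ≤ t ^ x := by positivity
  have h5 := mul_le_mul_of_nonneg_left h1 h4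
  have h6 : t ^ x * (1 + x * -(1 / t)) = t ^ x - x * (t ^ x / t) := by ring
  linarith

theorem mul_rpow_neg_sub_one_le {x t : ℝ} (hx : 0 < x) (hx1 : x ≤ 1) (ht : 1 < t) :
    x * t ^ (-x - 1) ≤ (t - 1) ^ (-x) - t ^ (-x) := by
  have h0 : 0 < t := by linarith
  have h1 := mul_rpow_sub_one_le hx hx1 ht.le
  have hA : 0 < t ^ x := by positivity
  have hB : 0 < (t - 1) ^ x := Real.rpow_pos_of_pos (by linarith) x
  rw [Real.rpow_sub_one h0.ne'] at h1 ⊢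
  rw [Real.rpow_neg (by linarith), Real.rpow_neg (by linarith)]
  set A := t ^ x
  set B := (t - 1) ^ x
  have h2 : B ≤ A := by
    have : 0 ≤ x * (A / t) := by positivity
    linarith
  have h3 : A⁻¹ * (x * (A / t)) ≤ B⁻¹ * (A - B) :=
    mul_le_mul (inv_anti₀ hB h2) h1 (by positivity) (by positivity)
  have h4 : A⁻¹ * (x * (A / t)) = x / t := by field_simp
  have h5 : B⁻¹ * (A - B) = A * (B⁻¹ - A⁻¹) := by field_simp
  rw [h4, h5] at h3
  calc x * (A⁻¹ / t) = A⁻¹ * (x / t) := by ring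
    _ ≤ A⁻¹ * (A * (B⁻¹ - A⁻¹)) := by gcongr
    _ = _ := by field_simp

/-- The quotient of the smaller by the larger one of `i + 1` and `j + 1`. -/
def quot (i j : ℕ) : ℝ := ((min i j + 1 : ℕ) : ℝ) / ((max i j + 1 : ℕ) : ℝ)

/-- The row sums for the Schur test. The indices j ≤ i and j > i contribute at most 1/x each, by the
two telescoping bounds above. -/
theorem sum_quot_rpow_le {x : ℝ} (hx : 0 < x) (hx1 : x ≤ 1) (i N : ℕ) :
    ∑ j ∈ Finset.range N, quot i j ^ x / ((j + 1 : ℕ) : ℝ) ≤ 2 / x := by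
  have hm : (0 : ℝ) < (i + 1 : ℕ) := by positivity
  have hM : (0 : ℝ) < ((i + 1 : ℕ) : ℝ) ^ x := by positivity
  have h1 : ∀ n : ℕ, n ≤ i + 1 → x * ∑ j ∈ Finset.range n, quot i j ^ x / ((j + 1 : ℕ) : ℝ) ≤
      (n : ℝ) ^ x / ((i + 1 : ℕ) : ℝ) ^ x := by
    intro n
    induction n with
    | zero =>
      intro _
      simp [Real.zero_rpow hx.ne']
    | succ n ih =>
      intro hn
      have h2 := ih (by omega)
      have h3 := mul_rpow_sub_one_le hx hx1 (t := ((n + 1 : ℕ) : ℝ)) (by simp)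
      rw [Real.rpow_sub_one (by positivity)] at h3
      have h4 : ((n + 1 : ℕ) : ℝ) - 1 = n := by simp
      rw [h4] at h3
      rw [Finset.sum_range_succ, mul_add, quot, min_eq_right (by omega), max_eq_left (by omega),
        Real.div_rpow (by positivity) (by positivity)]
      have h5 := (div_le_div_iff_of_pos_right hM).2 h3
      rw [sub_div] at h5
      have h6 : x * (((n + 1 : ℕ) : ℝ) ^ x / ((i + 1 : ℕ) : ℝ) ^ x / ((n + 1 : ℕ) : ℝ)) =
        x * (((n + 1 : ℕ) : ℝ) ^ x / ((n + 1 : ℕ) : ℝ)) / ((i + 1 : ℕ) : ℝ) ^ x := by ring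
      linarith
  -- The subtracted term is the part of the telescoping sum not yet used; it carries the induction
  -- and is dropped at the end.
  have h7 : ∀ n : ℕ, i + 1 ≤ n → x * ∑ j ∈ Finset.range n, quot i j ^ x / ((j + 1 : ℕ) : ℝ) ≤
      2 - ((i + 1 : ℕ) : ℝ) ^ x * (n : ℝ) ^ (-x) := by
    intro n hn
    induction n, hn using Nat.le_induction with
    | base =>
      refine (h1 _ le_rfl).trans (le_of_eq ?_)
      rw [div_self hM.ne', ← Real.rpow_add hm]
      norm_num
    | succ n hn ih =>
      have hn0 : (1 : ℝ) ≤ n := by exact_mod_cast (by omega : 1 ≤ n)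
      have h3 := mul_rpow_neg_sub_one_le hx hx1 (t := ((n + 1 : ℕ) : ℝ)) (by push_cast; linarith)
      rw [Real.rpow_sub_one (by positivity)] at h3
      have h4 : ((n + 1 : ℕ) : ℝ) - 1 = n := by simp
      rw [h4] at h3
      rw [Finset.sum_range_succ, mul_add, quot, min_eq_left (by omega), max_eq_right (by omega),
        Real.div_rpow (by positivity) (by positivity)]
      have h5 := mul_le_mul_of_nonneg_left h3 hM.le
      have h6 : x * (((i + 1 : ℕ) : ℝ) ^ x / ((n + 1 : ℕ) : ℝ) ^ x / ((n + 1 : ℕ) : ℝ)) =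
        ((i + 1 : ℕ) : ℝ) ^ x * (x * (((n + 1 : ℕ) : ℝ) ^ (-x) / ((n + 1 : ℕ) : ℝ))) := by
        rw [Real.rpow_neg (by positivity)]
        ring
      rw [h6]
      linarith
  rw [le_div_iff₀' hx]
  have h8 : (0 : ℝ) ≤ ((i + 1 : ℕ) : ℝ) ^ x * ((max N (i + 1) : ℕ) : ℝ) ^ (-x) := by positivity
  have h9 : ∑ j ∈ Finset.range N, quot i j ^ x / ((j + 1 : ℕ) : ℝ) ≤
      ∑ j ∈ Finset.range (max N (i + 1)), quot i j ^ x / ((j + 1 : ℕ) : ℝ) := by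
    refine Finset.sum_le_sum_of_subset_of_nonneg
      (Finset.range_subset_range.2 (le_max_left _ _)) fun j _ _ => ?_
    rw [quot]
    positivity
  have h10 := h7 (max N (i + 1)) (le_max_right _ _)
  nlinarith [mul_le_mul_of_nonneg_left h9 hx.le]

theorem rpow_mul_rpow_mul_rpow_le {m n x y : ℝ} (hm : 0 < m) (hmn : m ≤ n) (hxy : x ≤ y) :
    m ^ (-(1 / 2 + y)) * n ^ (-(1 / 2 + y)) * m ^ (2 * y) ≤
      m ^ (-(1 / 2) : ℝ) * n ^ (-(1 / 2) : ℝ) * (m / n) ^ x := by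
  have hn : 0 < n := hm.trans_le hmn
  have h1 : m ^ (-(1 / 2 + y)) * n ^ (-(1 / 2 + y)) * m ^ (2 * y) =
      m ^ (-(1 / 2) : ℝ) * n ^ (-(1 / 2) : ℝ) * (m / n) ^ y := by
    rw [Real.div_rpow hm.le hn.le, div_eq_mul_inv (m ^ y), ← Real.rpow_neg hn.le]
    rw [mul_right_comm, ← Real.rpow_add hm, mul_mul_mul_comm, ← Real.rpow_add hm,
      ← Real.rpow_add hn]
    ring_nf
  rw [h1]
  gcongr ?_ * ?_
  exact Real.rpow_le_rpow_of_exponent_ge (by positivity) ((div_le_one hn).2 hmn) hxy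

/-- With y = Re w - 1/2 ≥ x, the pair of m and n enters with modulus |a_m a_n| (mn)^{-1/2}
(min/max)^y. Lowering y to x leaves a symmetric kernel, to which the Schur test applies. -/
theorem majorant_le (a : ℕ → ℂ) (N : ℕ) {x : ℝ} (hx : 0 < x) (hx1 : x ≤ 1) {w : ℂ}
    (hw : 1 / 2 + x ≤ w.re) :
    majorant a N w ≤ 2 / x * ∑ j ∈ Finset.range N, ‖a j‖ ^ 2 := by
  have hw' : w ∈ halfPlane (1 / 2) := show 1 / 2 < w.re by linarith
  set y : ℝ := w.re - 1 / 2 with hy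
  have hyx : x ≤ y := by
    rw [hy]
    linarith
  have hpos : ∀ k : ℕ, (0 : ℝ) < (k + 1 : ℕ) := fun k => by positivity
  have hquot : ∀ i j, 0 ≤ quot i j := fun i j => by
    rw [quot]
    positivity
  have hnorm : ∀ j, ‖dterm a w j‖ = ‖a j‖ * ((j + 1 : ℕ) : ℝ) ^ (-(1 / 2 + y)) := fun j => by
    rw [dterm, norm_mul, Complex.norm_natCast_cpow_of_pos j.succ_pos, Complex.neg_re, hy]
    congr 3
    ring
  have hker : ∀ i j : ℕ, ((i + 1 : ℕ) : ℝ) ^ (-(1 / 2 + y)) * ((j + 1 : ℕ) : ℝ) ^ (-(1 / 2 + y)) *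
      ((min i j + 1 : ℕ) : ℝ) ^ (2 * w.re - 1) ≤
      ((i + 1 : ℕ) : ℝ) ^ (-(1 / 2) : ℝ) * ((j + 1 : ℕ) : ℝ) ^ (-(1 / 2) : ℝ) * quot i j ^ x := by
    intro i j
    have h2y : 2 * w.re - 1 = 2 * y := by
      rw [hy]
      ring
    rw [h2y, quot]
    rcases le_total i j with h | h
    · rw [min_eq_left h, max_eq_right h]
      exact rpow_mul_rpow_mul_rpow_le (hpos i) (by exact_mod_cast Nat.succ_le_succ h) hyx
    · rw [min_eq_right h, max_eq_left h]
      have := rpow_mul_rpow_mul_rpow_le (hpos j)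
        (by exact_mod_cast Nat.succ_le_succ h : ((j + 1 : ℕ) : ℝ) ≤ (i + 1 : ℕ)) hyx
      rwa [mul_comm (((i + 1 : ℕ) : ℝ) ^ _), mul_comm (((i + 1 : ℕ) : ℝ) ^ (-(1 / 2) : ℝ))]
  have hsq : ∀ k : ℕ, (((k + 1 : ℕ) : ℝ) ^ (-(1 / 2) : ℝ)) ^ 2 = 1 / (k + 1 : ℕ) := fun k => by
    rw [← Real.rpow_natCast, ← Real.rpow_mul (hpos k).le]
    norm_num [Real.rpow_neg_one]
  have hterm : ∀ i j : ℕ, (dterm a w i * (starRingEnd ℂ) (dterm a w j)).re *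
        ((min i j + 1 : ℕ) : ℝ) ^ (2 * w.re - 1) ≤
      1 / 2 * (‖a i‖ ^ 2 * (quot i j ^ x / (j + 1 : ℕ))) +
        1 / 2 * (‖a j‖ ^ 2 * (quot j i ^ x / (i + 1 : ℕ))) := by
    intro i j
    have hsymm : quot j i = quot i j := by
      rw [quot, quot, min_comm, max_comm]
    have hq : 0 ≤ quot i j ^ x := Real.rpow_nonneg (hquot i j) x
    set m := ((i + 1 : ℕ) : ℝ) ^ (-(1 / 2) : ℝ)
    set n := ((j + 1 : ℕ) : ℝ) ^ (-(1 / 2) : ℝ)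
    calc _ ≤ ‖dterm a w i * (starRingEnd ℂ) (dterm a w j)‖ * _ := by
          gcongr
          exact Complex.re_le_norm _
      _ = ‖a i‖ * ‖a j‖ * (((i + 1 : ℕ) : ℝ) ^ (-(1 / 2 + y)) *
            ((j + 1 : ℕ) : ℝ) ^ (-(1 / 2 + y)) * ((min i j + 1 : ℕ) : ℝ) ^ (2 * w.re - 1)) := by
        rw [norm_mul, RCLike.norm_conj, hnorm, hnorm]
        ring
      _ ≤ ‖a i‖ * ‖a j‖ * (m * n * quot i j ^ x) := by
        gcongr ?_ * ?_
        exact hker i j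
      _ = ((‖a i‖ * n) * (‖a j‖ * m)) * quot i j ^ x := by ring
      _ ≤ (1 / 2 * ((‖a i‖ * n) ^ 2 + (‖a j‖ * m) ^ 2)) * quot i j ^ x := by
        gcongr ?_ * _
        nlinarith [sq_nonneg (‖a i‖ * n - ‖a j‖ * m)]
      _ = _ := by
        rw [mul_pow, mul_pow, hsq, hsq, hsymm]
        ring
  rw [majorant_eq_sum a N hw']
  have hrow : ∑ i ∈ Finset.range N, ∑ j ∈ Finset.range N,
      ‖a i‖ ^ 2 * (quot i j ^ x / (j + 1 : ℕ)) ≤ 2 / x * ∑ j ∈ Finset.range N, ‖a j‖ ^ 2 := by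
    rw [Finset.mul_sum]
    refine Finset.sum_le_sum fun i _ => ?_
    rw [← Finset.mul_sum, mul_comm (2 / x)]
    gcongr
    exact sum_quot_rpow_le hx hx1 i N
  calc _ ≤ ∑ i ∈ Finset.range N, ∑ j ∈ Finset.range N,
        (1 / 2 * (‖a i‖ ^ 2 * (quot i j ^ x / (j + 1 : ℕ))) +
          1 / 2 * (‖a j‖ ^ 2 * (quot j i ^ x / (i + 1 : ℕ)))) :=
        Finset.sum_le_sum fun i _ => Finset.sum_le_sum fun j _ => hterm i j
    _ = ∑ i ∈ Finset.range N, ∑ j ∈ Finset.range N,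
        ‖a i‖ ^ 2 * (quot i j ^ x / (j + 1 : ℕ)) := by
      simp only [Finset.sum_add_distrib]
      rw [Finset.sum_comm (f := fun i j => 1 / 2 * (‖a j‖ ^ 2 * (quot j i ^ x / (i + 1 : ℕ)))),
        ← two_mul]
      simp only [← Finset.mul_sum]
      ring
    _ ≤ _ := hrow

/-! ### Dirichlet polynomials as elements of the Hardy space -/

theorem exists_eq_sum_single (p : DirichletPoly) :
    ∃ N : ℕ, p = ∑ j ∈ Finset.range N, MonoidAlgebra.single j.succPNat (p.coeff j.succPNat) := by
  obtain ⟨N, hN⟩ := (p.coeff.support.image PNat.natPred).exists_nat_subset_range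
  refine ⟨N, MonoidAlgebra.coeff_injective (Finsupp.ext fun n => ?_)⟩
  rw [MonoidAlgebra.coeff_sum, Finsupp.finsetSum_apply]
  have hn : n = n.natPred.succPNat := (PNat.succPNat_natPred n).symm
  rw [Finset.sum_eq_single n.natPred]
  · rw [← hn]
    simp
  · intro j _ hj
    rw [MonoidAlgebra.coeff_single, Finsupp.single_apply, if_neg]
    rintro rfl
    simp at hj
  · intro h
    have h0 : p.coeff n = 0 := by
      by_contra h1
      exact h (hN (Finset.mem_image_of_mem _ (Finsupp.mem_support_iff.2 h1)))
    rw [← hn, h0]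
    simp

theorem exists_eq_sum_dterm (p : DirichletPoly) :
    ∃ (a : ℕ → ℂ) (N : ℕ), (∀ w, evalAt w p = ∑ j ∈ Finset.range N, dterm a w j) ∧
      ∑ j ∈ Finset.range N, ‖a j‖ ^ 2 ≤ ‖shift 0 p‖ ^ 2 := by
  obtain ⟨N, hN⟩ := exists_eq_sum_single p
  refine ⟨fun j => p.coeff j.succPNat, N, fun w => ?_, ?_⟩
  · conv_lhs => rw [hN]
    simp [dterm]
  · have h1 := lp.sum_rpow_le_norm_rpow (p := 2) (by norm_num) (shift 0 p)
      ((Finset.range N).map ⟨Nat.succPNat, Nat.succPNat_injective⟩)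
    simpa [shift_apply] using h1

theorem isUniformLimit_evalAt_comp {φ : ℂ → ℂ} {c : ℂ} (hφ : IsUniformLimit φ c)
    (p : DirichletPoly) : IsUniformLimit (fun s => evalAt (φ s) p) (evalAt c p) := by
  induction p using MonoidAlgebra.induction_linear with
  | zero => simpa using isUniformLimit_const 0
  | add p q hp hq => simpa using hp.add hq
  | single n a =>
    have hn0 : (n : ℂ) ≠ 0 := by exact_mod_cast n.ne_zero
    simpa [Complex.cpow_def_of_ne_zero hn0] using
      ((hφ.const_mul (-Complex.log n)).exp).const_mul a

/-- A mean value property at +∞: the majorant is the real part of an exponential sum, so composition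
with φ is the real part of a uniform limit, with constant term obtained by inserting c. -/
theorem hasMean_majorant_comp {φ : ℂ → ℂ} {c : ℂ} (hφ : IsUniformLimit φ c)
    (hm : MapsTo φ (halfPlane 0) (halfPlane (1 / 2))) (a : ℕ → ℂ) (N : ℕ) {σ : ℝ} (hσ : 0 < σ) :
    HasMean (fun t : ℝ => majorant a N (φ (σ + t * Complex.I))) (majorant a N c) := by
  rw [majorant_eq a N (hφ.half_lt_re hm)]
  have h1 : ∀ i j, IsUniformLimit (fun s => pairExp i j (φ s)) (pairExp i j c) := fun i j =>
    ((hφ.const_mul _).add (isUniformLimit_const _)).exp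
  have h2 := (IsUniformLimit.sum (Finset.range N) fun i _ => IsUniformLimit.sum (Finset.range N)
    fun j _ => (h1 (max i j) (min i j)).const_mul
      (a (max i j) * (starRingEnd ℂ) (a (min i j)))).hasMean hσ
  refine (congrArg (HasMean · _) (funext fun t => ?_)).mp h2.re
  exact (majorant_eq a N (hm (vertical_mem_halfPlane hσ t))).symm

theorem denseRange_shift_zero : DenseRange (shift 0) := by
  intro f
  have h1 := lp.hasSum_single (by norm_num) f
  refine mem_closure_of_tendsto h1 (Eventually.of_forall fun S => ?_)
  refine ⟨∑ n ∈ S, MonoidAlgebra.single n (f n), ?_⟩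
  simp [map_sum, shift_single]

theorem opNorm_le_of_shift {D : HardySpace →L[ℂ] HardySpace} {K : ℝ} (hK : 0 ≤ K)
    (hD : ∀ p, ‖D (shift 0 p)‖ ≤ K * ‖shift 0 p‖) : ‖D‖ ≤ K := by
  refine D.opNorm_le_bound hK fun f => ?_
  refine denseRange_shift_zero.induction_on (p := fun f => ‖D f‖ ≤ K * ‖f‖) f ?_ hD
  exact isClosed_le D.continuous.norm (continuous_const.mul continuous_norm)

theorem eval_shift_zero (p : DirichletPoly) {s : ℂ} (hs : s ∈ halfPlane (1 / 2)) :
    eval (shift 0 p) s = evalAt s p := by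
  simpa using eval_shift 0 p hs

/-! ### Composition operators with symbols of characteristic zero -/

theorem exists_eval_eq_evalAt_comp {φ : ℂ → ℂ} {c : ℂ} (hφ : IsUniformLimit φ c)
    (hm : MapsTo φ (halfPlane 0) (halfPlane (1 / 2))) {x : ℝ} (hx : 0 < x) (hx1 : x ≤ 1)
    (hc : 1 / 2 + x ≤ c.re) (p : DirichletPoly) :
    ∃ b : HardySpace, ‖b‖ ^ 2 ≤ 2 / x * ‖shift 0 p‖ ^ 2 ∧
      ∀ s ∈ halfPlane (1 / 2), eval b s = evalAt (φ s) p := by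
  obtain ⟨a, N, ha, haN⟩ := exists_eq_sum_dterm p
  obtain ⟨b, hb, hbe⟩ := (isUniformLimit_evalAt_comp hφ p).exists_eval_eq
    (U := fun s => majorant a N (φ s)) (fun σ hσ => hasMean_majorant_comp hφ hm a N hσ)
    (fun s hs => by
      rw [ha]
      exact norm_sum_dterm_sq_le a N (hm hs))
  refine ⟨b, hb.trans ((majorant_le a N hx hx1 hc).trans ?_), hbe⟩
  gcongr

/-- The operator is built on Dirichlet polynomials and extended by density. The chosen preimages
depend linearly on `p` because a Hardy space element is determined by its values. -/
theorem exists_isCompositionOperator {φ : ℂ → ℂ} {c : ℂ} (hφ : IsUniformLimit φ c)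
    (hm : MapsTo φ (halfPlane 0) (halfPlane (1 / 2))) :
    ∃ T : HardySpace →L[ℂ] HardySpace, IsCompositionOperator φ T := by
  have hc := hφ.half_lt_re hm
  set x : ℝ := min 1 (c.re - 1 / 2) with hx
  have hx0 : 0 < x := lt_min one_pos (by linarith)
  have hxc : 1 / 2 + x ≤ c.re := by linarith [min_le_right 1 (c.re - 1 / 2)]
  choose b hb hbe using exists_eval_eq_evalAt_comp hφ hm hx0 (min_le_left _ _) hxc
  let F : DirichletPoly →ₗ[ℂ] HardySpace :=
    { toFun := b
      map_add' := fun p q => eval_injective fun s hs => by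
        rw [eval_add hs, hbe _ s hs, hbe _ s hs, hbe _ s hs, map_add]
      map_smul' := fun r p => eval_injective fun s hs => by
        rw [RingHom.id_apply, eval_smul, hbe _ s hs, hbe _ s hs, map_smul, smul_eq_mul] }
  have hF : ∃ C, ∀ p, ‖F p‖ ≤ C * ‖shift 0 p‖ := ⟨√(2 / x), fun p => by
    rw [← Real.sqrt_sq (norm_nonneg (shift 0 p)), ← Real.sqrt_mul (by positivity)]
    exact Real.le_sqrt_of_sq_le (hb p)⟩
  refine ⟨F.extendOfNorm (shift 0), fun f s hs => ?_⟩
  have hs' : φ s ∈ halfPlane (1 / 2) := hm (halfPlane_subset (by norm_num) hs)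
  refine denseRange_shift_zero.induction_on
    (p := fun f => eval (F.extendOfNorm (shift 0) f) s = eval f (φ s)) f ?_ fun p => ?_
  · exact isClosed_eq ((continuous_eval hs).comp (ContinuousLinearMap.continuous _))
      (continuous_eval hs')
  · rw [LinearMap.extendOfNorm_eq denseRange_shift_zero hF, eval_shift_zero p hs']
    exact hbe p s hs

theorem norm_sub_sq_le_two_mul (a b : ℂ) : ‖a - b‖ ^ 2 ≤ 2 * (‖a‖ ^ 2 + ‖b‖ ^ 2) := by
  have h1 := norm_sub_le a b
  nlinarith [sq_nonneg (‖a‖ - ‖b‖), norm_nonneg (a - b), norm_nonneg a, norm_nonneg b]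

/-- Estimate of the difference of two composition operators on a Dirichlet polynomial `p`, where
the symbols are pseudohyperbolically close wherever `p` is not small on their values. -/
theorem norm_sub_shift_sq_le {φ ψ : ℂ → ℂ} {c d : ℂ} (hφ : IsUniformLimit φ c)
    (hψ : IsUniformLimit ψ d) (hφm : MapsTo φ (halfPlane 0) (halfPlane (1 / 2)))
    (hψm : MapsTo ψ (halfPlane 0) (halfPlane (1 / 2))) {x : ℝ} (hx : 0 < x) (hx1 : x ≤ 1)
    (hc : 1 / 2 + x ≤ c.re) (hd : 1 / 2 + x ≤ d.re) {S T : HardySpace →L[ℂ] HardySpace}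
    (hS : IsCompositionOperator φ S) (hT : IsCompositionOperator ψ T) (p : DirichletPoly)
    {κ r : ℝ} (hr : 0 ≤ r)
    (h : ∀ s ∈ halfPlane 0,
      ‖φ s - ψ s‖ ≤ κ * (2 * min ((φ s).re - 1 / 2) ((ψ s).re - 1 / 2)) ∨
      ‖evalAt (φ s) p‖ ^ 2 ≤ r ∧ ‖evalAt (ψ s) p‖ ^ 2 ≤ r) :
    ‖(S - T) (shift 0 p)‖ ^ 2 ≤ κ ^ 2 * (4 / x) * ‖shift 0 p‖ ^ 2 + 4 * r := by
  obtain ⟨a, N, ha, haN⟩ := exists_eq_sum_dterm p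
  obtain ⟨b, hb, hbe⟩ := ((isUniformLimit_evalAt_comp hφ p).sub
    (isUniformLimit_evalAt_comp hψ p)).exists_eval_eq
    -- One majorant for both alternatives: the first summand covers close symbols, and 4r = 2(r + r)
    -- covers points where both values of `p` are small. Its vertical mean is explicit.
    (U := fun s => κ ^ 2 * (majorant a N (φ s) + majorant a N (ψ s)) + 4 * r)
    (fun σ hσ => (((hasMean_majorant_comp hφ hφm a N hσ).add
      (hasMean_majorant_comp hψ hψm a N hσ)).real_const_mul _).add (hasMean_const _))
    (fun s hs => by
      have hφs : 1 / 2 < (φ s).re := hφm hs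
      have hψs : 1 / 2 < (ψ s).re := hψm hs
      have hM : 0 ≤ majorant a N (φ s) + majorant a N (ψ s) :=
        add_nonneg (majorant_nonneg a N (hφm hs)) (majorant_nonneg a N (hψm hs))
      rcases h s hs with h1 | ⟨h1, h2⟩
      · set m : ℝ := min ((φ s).re - 1 / 2) ((ψ s).re - 1 / 2) with hm
        have hm0 : 0 < m := lt_min (by linarith) (by linarith)
        have h3 := norm_sum_dterm_sub_sq_le a N (w := ψ s) (v := φ s) hm0
          (by linarith [min_le_right ((φ s).re - 1 / 2) ((ψ s).re - 1 / 2)])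
          (by linarith [min_le_left ((φ s).re - 1 / 2) ((ψ s).re - 1 / 2)])
        rw [← ha, ← ha] at h3
        have h4 : ‖φ s - ψ s‖ ^ 2 ≤ (κ * (2 * m)) ^ 2 := by gcongr
        have h5 := h3.trans (mul_le_mul_of_nonneg_right h4 (by linarith))
        have h6 : (2 * m) ^ 2 * ‖evalAt (φ s) p - evalAt (ψ s) p‖ ^ 2 ≤
            (2 * m) ^ 2 * (κ ^ 2 * (majorant a N (φ s) + majorant a N (ψ s))) := by
          linarith
        have h7 := le_of_mul_le_mul_left h6 (by positivity)
        linarith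
      · have h3 := norm_sub_sq_le_two_mul (evalAt (φ s) p) (evalAt (ψ s) p)
        have h4 := mul_nonneg (sq_nonneg κ) hM
        linarith)
  have hbS : (S - T) (shift 0 p) = b := eval_injective fun s hs => by
    have hs0 := halfPlane_subset (by norm_num : (0 : ℝ) ≤ 1 / 2) hs
    rw [_root_.sub_apply, eval_sub hs, hS _ s hs, hT _ s hs,
      eval_shift_zero p (hφm hs0), eval_shift_zero p (hψm hs0), hbe s hs]
  rw [hbS]
  have h1 := (majorant_le a N hx hx1 hc).trans (mul_le_mul_of_nonneg_left haN (by positivity))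
  have h2 := (majorant_le a N hx hx1 hd).trans (mul_le_mul_of_nonneg_left haN (by positivity))
  calc _ ≤ _ := hb
    _ ≤ κ ^ 2 * (2 / x * ‖shift 0 p‖ ^ 2 + 2 / x * ‖shift 0 p‖ ^ 2) + 4 * r := by gcongr
    _ = _ := by ring

theorem norm_sub_le_of_pseudohyperbolic {φ ψ : ℂ → ℂ} {c d : ℂ} (hφ : IsUniformLimit φ c)
    (hψ : IsUniformLimit ψ d) (hφm : MapsTo φ (halfPlane 0) (halfPlane (1 / 2)))
    (hψm : MapsTo ψ (halfPlane 0) (halfPlane (1 / 2))) {x : ℝ} (hx : 0 < x) (hx1 : x ≤ 1)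
    (hc : 1 / 2 + x ≤ c.re) (hd : 1 / 2 + x ≤ d.re) {S T : HardySpace →L[ℂ] HardySpace}
    (hS : IsCompositionOperator φ S) (hT : IsCompositionOperator ψ T) {κ : ℝ} (hκ : 0 ≤ κ)
    (h : ∀ s ∈ halfPlane 0,
      ‖φ s - ψ s‖ ≤ κ * (2 * min ((φ s).re - 1 / 2) ((ψ s).re - 1 / 2))) :
    ‖S - T‖ ≤ κ * √(4 / x) := by
  refine opNorm_le_of_shift (by positivity) fun p => ?_
  have h1 := norm_sub_shift_sq_le hφ hψ hφm hψm hx hx1 hc hd hS hT p le_rfl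
    fun s hs => Or.inl (h s hs)
  refine (sq_le_sq₀ (norm_nonneg _) (by positivity)).1 (h1.trans (le_of_eq ?_))
  rw [mul_pow, mul_pow, Real.sq_sqrt (by positivity)]
  ring

/-! ### Compact differences -/

/-- The orthogonal projection of the Hardy space onto the coordinates in `S`. -/
def coordProj (S : Finset ℕ+) : HardySpace →L[ℂ] HardySpace :=
  ∑ n ∈ S, (ContinuousLinearMap.toSpanSingleton ℂ (lp.single 2 n (1 : ℂ) : HardySpace)) ∘L
    innerSL ℂ (lp.single 2 n (1 : ℂ) : HardySpace)

theorem coordProj_apply (S : Finset ℕ+) (f : HardySpace) :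
    coordProj S f = ∑ n ∈ S, lp.single 2 n (f n) := by
  simp [coordProj, lp.inner_single_left, ← lp.single_smul]

theorem isCompactOperator_coordProj (S : Finset ℕ+) : IsCompactOperator (coordProj S) := by
  change coordProj S ∈ compactOperator (RingHom.id ℂ) HardySpace HardySpace
  refine Submodule.sum_mem _ fun n _ => ?_
  exact (isCompactOperator_of_locallyCompactSpace_dom
    (innerSL ℂ (lp.single 2 n (1 : ℂ) : HardySpace))).clm_comp
    (ContinuousLinearMap.toSpanSingleton ℂ (lp.single 2 n (1 : ℂ) : HardySpace))

theorem norm_sub_coordProj_le (S : Finset ℕ+) (f : HardySpace) : ‖f - coordProj S f‖ ≤ ‖f‖ := by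
  have h1 := lp.norm_compl_sum_single (p := 2) (by norm_num) f S
  simp only [ENNReal.toReal_ofNat, Real.rpow_ofNat] at h1
  rw [coordProj_apply]
  refine (sq_le_sq₀ (norm_nonneg _) (norm_nonneg _)).1 ?_
  rw [h1]
  have : 0 ≤ ∑ n ∈ S, ‖f n‖ ^ 2 := by positivity
  linarith

theorem sub_coordProj_apply_of_mem {S : Finset ℕ+} {n : ℕ+} (hn : n ∈ S) (f : HardySpace) :
    (f - coordProj S f) n = 0 := by
  rw [coordProj_apply, lp.coeFn_sub, Pi.sub_apply, lp.coeFn_sum, Finset.sum_apply,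
    Finset.sum_eq_single n]
  · simp
  · intro m _ hm
    simp [lp.single_apply, hm.symm]
  · exact fun h => absurd hn h

/-- Removing finitely many frequencies leaves a Dirichlet polynomial, so the estimates for
polynomials still apply. -/
theorem exists_shift_eq_sub_coordProj (S : Finset ℕ+) (p : DirichletPoly) :
    ∃ q, shift 0 q = shift 0 p - coordProj S (shift 0 p) := by
  refine ⟨p - ∑ n ∈ S, MonoidAlgebra.single n (p.coeff n), ?_⟩
  simp [coordProj_apply, shift_single, shift_apply]

/-- The compact operators (A - B)P_S converge to A - B in norm. On the complementary frequencies,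
points with close symbols cost a multiple of κ², and the others cost a tail sum that vanishes as S
grows. -/
theorem isCompactOperator_sub {φ ψ : ℂ → ℂ} {c d : ℂ} (hφ : IsUniformLimit φ c)
    (hψ : IsUniformLimit ψ d) (hφm : MapsTo φ (halfPlane 0) (halfPlane (1 / 2)))
    (hψm : MapsTo ψ (halfPlane 0) (halfPlane (1 / 2))) {x : ℝ} (hx : 0 < x) (hx1 : x ≤ 1)
    (hc : 1 / 2 + x ≤ c.re) (hd : 1 / 2 + x ≤ d.re) {A B : HardySpace →L[ℂ] HardySpace}
    (hA : IsCompositionOperator φ A) (hB : IsCompositionOperator ψ B)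
    (h : ∀ κ : ℝ, 0 < κ → ∃ δ : ℝ, 0 < δ ∧ ∀ s ∈ halfPlane 0,
      ‖φ s - ψ s‖ ≤ κ * (2 * min ((φ s).re - 1 / 2) ((ψ s).re - 1 / 2)) ∨
      1 / 2 + δ ≤ (φ s).re ∧ 1 / 2 + δ ≤ (ψ s).re) :
    IsCompactOperator (A - B) := by
  refine isCompactOperator_of_tendsto (l := atTop) (F := fun S => (A - B) ∘L coordProj S) ?_
    (Eventually.of_forall fun S => (isCompactOperator_coordProj S).clm_comp (A - B))
  rw [tendsto_iff_norm_sub_tendsto_zero, Metric.tendsto_nhds]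
  intro ε hε
  -- With this κ, κ² · 4/x = (ε/2)²/2; the tail bound (ε/2)²/8, multiplied by 4, supplies the other
  -- half of (ε/2)².
  have hκ : 0 < ε / 2 * √(x / 8) := by positivity
  obtain ⟨δ, hδ, hδs⟩ := h _ hκ
  filter_upwards [(tendsto_tailSum (1 / 2 + δ)).eventually_le_const
    (by positivity : 0 < (ε / 2) ^ 2 / 8)] with S hS
  rw [dist_zero_right, norm_norm, norm_sub_rev]
  refine lt_of_le_of_lt (opNorm_le_of_shift (K := ε / 2) (by positivity) fun p => ?_)
    (half_lt_self hε)
  obtain ⟨q, hq⟩ := exists_shift_eq_sub_coordProj S p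
  have hqp : ‖shift 0 q‖ ≤ ‖shift 0 p‖ := by
    rw [hq]
    exact norm_sub_coordProj_le S _
  have h1 : (A - B - (A - B) ∘L coordProj S) (shift 0 p) = (A - B) (shift 0 q) := by
    rw [hq, map_sub]
    rfl
  rw [h1]
  have hsmall : ∀ w : ℂ, 1 / 2 + δ ≤ w.re →
      ‖evalAt w q‖ ^ 2 ≤ tailSum (1 / 2 + δ) S * ‖shift 0 q‖ ^ 2 := fun w hw => by
    rw [← eval_shift_zero q (show 1 / 2 < w.re by linarith)]
    refine norm_eval_sq_le (by linarith) hw S _ fun n hn => ?_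
    rw [hq]
    exact sub_coordProj_apply_of_mem hn _
  have h2 := norm_sub_shift_sq_le hφ hψ hφm hψm hx hx1 hc hd hA hB q
    (mul_nonneg (tailSum_nonneg (1 / 2 + δ) S) (sq_nonneg ‖shift 0 q‖))
    fun s hs => (hδs s hs).imp_right fun h3 => ⟨hsmall _ h3.1, hsmall _ h3.2⟩
  refine (sq_le_sq₀ (norm_nonneg _) (by positivity)).1 (h2.trans ?_)
  have h3 : (ε / 2 * √(x / 8)) ^ 2 * (4 / x) = (ε / 2) ^ 2 / 2 := by
    rw [mul_pow, Real.sq_sqrt (by positivity)]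
    field_simp
    norm_num
  rw [h3, mul_pow]
  have h4 : ‖shift 0 q‖ ^ 2 ≤ ‖shift 0 p‖ ^ 2 := by gcongr
  have h5 := mul_le_mul_of_nonneg_right hS (sq_nonneg ‖shift 0 q‖)
  have h6 := mul_le_mul_of_nonneg_left h4 (sq_nonneg (ε / 2))
  linarith

/-! ### Gordon-Hedenmalm maps of characteristic zero -/

theorem IsGordonHedenmalm.exists_isUniformLimit {φ : ℂ → ℂ} (h : IsGordonHedenmalm φ 0) :
    MapsTo φ (halfPlane 0) (halfPlane (1 / 2)) ∧ ∃ c, IsUniformLimit φ c := by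
  obtain ⟨-, ψ, c, hφ, hu, hm, -⟩ := h
  have hφψ : ∀ s ∈ halfPlane 0, ψ s = φ s := fun s hs => by simp [hφ s hs]
  refine ⟨fun s hs => hφψ s hs ▸ hm rfl hs, c 1, ?_⟩
  refine IsUniformLimit.congr (g := ψ) ⟨fun N => ∑ j ∈ Finset.range N,
    MonoidAlgebra.single j.succPNat (c (j + 1)), fun ε hε => ?_, ?_⟩ hφψ
  · refine (hu ε hε).congr (Eventually.of_forall fun N s _ => ?_)
    simp only [map_sum, evalAt_single, Nat.succPNat_coe]
    rw [Finset.range_eq_Ico, Finset.sum_Ico_add' (fun n => c n * (n : ℂ) ^ (-s)) 0 N 1]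
    rfl
  -- Every nonempty partial sum has constant term `c 1`, since index j stands for n = j + 1.
  · refine tendsto_const_nhds.congr' ?_
    filter_upwards [eventually_gt_atTop 0] with N hN
    rw [map_sum, Finset.sum_eq_single 0]
    · exact ((leading_single _ _).trans (if_pos rfl)).symm
    · intro j _ hj
      have : j.succPNat ≠ 1 := fun h0 => hj (Nat.succPNat_injective h0)
      simp [this]
    · intro h0
      exact absurd (Finset.mem_range.2 hN) h0

theorem one_le_norm_one_add_sq {w : ℂ} (hw : 1 / 2 < w.re) : 1 ≤ ‖1 + w‖ ^ 2 := by
  have h1 := Complex.re_le_norm (1 + w)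
  simp only [Complex.add_re, Complex.one_re] at h1
  nlinarith

theorem contactGauge_pos {φ₀ φ₁ : ℂ → ℂ} {s : ℂ} (h₀ : 1 / 2 < (φ₀ s).re)
    (h₁ : 1 / 2 < (φ₁ s).re) : 0 < contactGauge φ₀ φ₁ s := by
  have h2 := one_le_norm_one_add_sq h₀
  have h3 := one_le_norm_one_add_sq h₁
  exact lt_min (div_pos (by linarith) (by linarith)) (div_pos (by linarith) (by linarith))

/-- The gauge enters the upper estimates only through this bound: the factor |1 + φ|^{-2} ≤ 1 merely
strengthens the hypothesis on the symbols. -/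
theorem contactGauge_le {φ₀ φ₁ : ℂ → ℂ} {s : ℂ} (h₀ : 1 / 2 < (φ₀ s).re)
    (h₁ : 1 / 2 < (φ₁ s).re) :
    contactGauge φ₀ φ₁ s ≤ min ((φ₀ s).re - 1 / 2) ((φ₁ s).re - 1 / 2) :=
  min_le_min (div_le_self (by linarith) (one_le_norm_one_add_sq h₀))
    (div_le_self (by linarith) (one_le_norm_one_add_sq h₁))

end DirichletHardy

end

/-! ### The segment joining the two symbols -/

open DirichletHardy in
theorem mainTheorem9 (φ₀ φ₁ : ℂ → ℂ)
    (h₀ : DirichletHardy.IsGordonHedenmalm φ₀ 0) (h₁ : DirichletHardy.IsGordonHedenmalm φ₁ 0)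
    (C : ℝ) (hC : 0 < C)
    (hbound : ∀ s ∈ DirichletHardy.halfPlane 0,
      ‖φ₀ s - φ₁ s‖ ≤ C * DirichletHardy.contactGauge φ₀ φ₁ s) :
    ∃ T₀ T₁ : DirichletHardy.HardySpace →L[ℂ] DirichletHardy.HardySpace,
      DirichletHardy.IsCompositionOperator φ₀ T₀ ∧
      DirichletHardy.IsCompositionOperator φ₁ T₁ ∧
      T₁ ∈ connectedComponentIn DirichletHardy.compositionOperators T₀ ∧
      ((fun s : ℂ => φ₀ s - φ₁ s)
          =o[comap (DirichletHardy.contactGauge φ₀ φ₁) (𝓝 0) ⊓ 𝓟 (DirichletHardy.halfPlane 0)]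
          DirichletHardy.contactGauge φ₀ φ₁ →
        IsCompactOperator (T₀ - T₁)) := by
  obtain ⟨hm₀, c₀, hc₀⟩ := h₀.exists_isUniformLimit
  obtain ⟨hm₁, c₁, hc₁⟩ := h₁.exists_isUniformLimit
  have hre₀ := hc₀.half_lt_re hm₀
  have hre₁ := hc₁.half_lt_re hm₁
  obtain ⟨x, hx0, hx1, hxc₀, hxc₁⟩ : ∃ x : ℝ, 0 < x ∧ x ≤ 1 ∧ 1 / 2 + x ≤ c₀.re ∧
      1 / 2 + x ≤ c₁.re := by
    refine ⟨min 1 (min (c₀.re - 1 / 2) (c₁.re - 1 / 2)), lt_min one_pos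
      (lt_min (by linarith) (by linarith)), min_le_left _ _, ?_, ?_⟩
    · have := (min_le_right 1 (min (c₀.re - 1 / 2) (c₁.re - 1 / 2))).trans (min_le_left _ _)
      linarith
    · have := (min_le_right 1 (min (c₀.re - 1 / 2) (c₁.re - 1 / 2))).trans (min_le_right _ _)
      linarith
  set Φ : ℝ → ℂ → ℂ := fun r s => (1 - r : ℝ) * φ₀ s + (r : ℝ) * φ₁ s with hΦ
  have hΦu : ∀ r : ℝ, IsUniformLimit (Φ r) ((1 - r : ℝ) * c₀ + (r : ℝ) * c₁) := fun r =>
    (hc₀.const_mul _).add (hc₁.const_mul _)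
  have hΦre : ∀ (r : ℝ) (z w : ℂ), (((1 - r : ℝ) : ℂ) * z + (r : ℝ) * w).re =
      (1 - r) * z.re + r * w.re := fun r z w => by
    rw [Complex.add_re, Complex.re_ofReal_mul, Complex.re_ofReal_mul]
  have hconv : ∀ r ∈ Icc (0 : ℝ) 1, ∀ (z w : ℂ) (y : ℝ), y ≤ z.re → y ≤ w.re →
      y ≤ (((1 - r : ℝ) : ℂ) * z + (r : ℝ) * w).re := by
    intro r hr z w y hz hw
    rw [hΦre]
    have h1 := mul_le_mul_of_nonneg_left hz (sub_nonneg.2 hr.2)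
    have h2 := mul_le_mul_of_nonneg_left hw hr.1
    linarith
  -- By convexity, every symbol on the segment is at least as far from the line Re = 1/2 as the
  -- nearer endpoint.
  have hΦmin : ∀ r ∈ Icc (0 : ℝ) 1, ∀ s,
      min ((φ₀ s).re - 1 / 2) ((φ₁ s).re - 1 / 2) ≤ (Φ r s).re - 1 / 2 := by
    intro r hr s
    have := hconv r hr (φ₀ s) (φ₁ s) (1 / 2 + min ((φ₀ s).re - 1 / 2) ((φ₁ s).re - 1 / 2))
      (by linarith [min_le_left ((φ₀ s).re - 1 / 2) ((φ₁ s).re - 1 / 2)])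
      (by linarith [min_le_right ((φ₀ s).re - 1 / 2) ((φ₁ s).re - 1 / 2)])
    linarith
  have hgauge : ∀ s ∈ halfPlane 0, 0 < contactGauge φ₀ φ₁ s ∧
      contactGauge φ₀ φ₁ s ≤ min ((φ₀ s).re - 1 / 2) ((φ₁ s).re - 1 / 2) := fun s hs =>
    ⟨contactGauge_pos (hm₀ hs) (hm₁ hs), contactGauge_le (hm₀ hs) (hm₁ hs)⟩
  have hΦm : ∀ r ∈ Icc (0 : ℝ) 1, MapsTo (Φ r) (halfPlane 0) (halfPlane (1 / 2)) := by
    intro r hr s hs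
    have h2 := hgauge s hs
    have h3 := hΦmin r hr s
    show 1 / 2 < (Φ r s).re
    linarith
  choose! T hT using fun (r : ℝ) (hr : r ∈ Icc (0 : ℝ) 1) =>
    exists_isCompositionOperator (hΦu r) (hΦm r hr)
  have h0mem : (0 : ℝ) ∈ Icc (0 : ℝ) 1 := ⟨le_rfl, zero_le_one⟩
  have h1mem : (1 : ℝ) ∈ Icc (0 : ℝ) 1 := ⟨zero_le_one, le_rfl⟩
  have hT₀ : IsCompositionOperator φ₀ (T 0) := by
    have h2 : Φ 0 = φ₀ := by
      ext s
      simp [hΦ]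
    exact h2 ▸ hT 0 h0mem
  have hT₁ : IsCompositionOperator φ₁ (T 1) := by
    have h2 : Φ 1 = φ₁ := by
      ext s
      simp [hΦ]
    exact h2 ▸ hT 1 h1mem
  have hTlip : ∀ r ∈ Icc (0 : ℝ) 1, ∀ t ∈ Icc (0 : ℝ) 1,
      dist (T r) (T t) ≤ C / 2 * √(4 / x) * dist r t := by
    intro r hr t ht
    rw [dist_eq_norm, Real.dist_eq]
    refine (norm_sub_le_of_pseudohyperbolic (hΦu r) (hΦu t) (hΦm r hr) (hΦm t ht) hx0 hx1
      (hconv r hr _ _ _ hxc₀ hxc₁) (hconv t ht _ _ _ hxc₀ hxc₁) (hT r hr) (hT t ht)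
      -- Since Φ_r - Φ_t = (t - r)(φ₀ - φ₁), the hypothesis gives the bound C|r - t| times the
      -- distance to the line; the 1/2 offsets the factor 2 in the estimate.
      (κ := C / 2 * |r - t|) (by positivity) fun s hs => ?_).trans (le_of_eq (by ring))
    obtain ⟨-, h3⟩ := hgauge s hs
    have h4 : Φ r s - Φ t s = ((t - r : ℝ) : ℂ) * (φ₀ s - φ₁ s) := by
      simp only [hΦ]
      push_cast
      ring
    rw [h4, norm_mul, Complex.norm_real, Real.norm_eq_abs, abs_sub_comm]
    have h5 := le_min (hΦmin r hr s) (hΦmin t ht s)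
    calc |r - t| * ‖φ₀ s - φ₁ s‖
        ≤ |r - t| * (C * min ((Φ r s).re - 1 / 2) ((Φ t s).re - 1 / 2)) := by
          gcongr
          exact (hbound s hs).trans (mul_le_mul_of_nonneg_left (h3.trans h5) hC.le)
      _ = _ := by ring
  have hTcont : ContinuousOn T (Icc 0 1) :=
    (LipschitzOnWith.of_dist_le' hTlip).continuousOn
  have hTmem : T '' Icc 0 1 ⊆ compositionOperators := by
    rintro _ ⟨r, hr, rfl⟩
    exact ⟨Φ r, (hΦu r).differentiableOn one_half_pos,
      (hΦm r hr).mono_left (halfPlane_subset one_half_pos.le), hT r hr⟩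
  refine ⟨T 0, T 1, hT₀, hT₁, ?_, fun ho => ?_⟩
  · exact (isPreconnected_Icc.image T hTcont).subset_connectedComponentIn
      (mem_image_of_mem T h0mem) hTmem (mem_image_of_mem T h1mem)
  · refine isCompactOperator_sub hc₀ hc₁ hm₀ hm₁ hx0 hx1 hxc₀ hxc₁ hT₀ hT₁ fun κ hκ => ?_
    have h2 := (isLittleO_iff.1 ho) hκ
    rw [eventually_inf_principal, eventually_comap, Metric.eventually_nhds_iff] at h2
    obtain ⟨δ, hδ, hδs⟩ := h2
    refine ⟨δ, hδ, fun s hs => ?_⟩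
    obtain ⟨h3, h4⟩ := hgauge s hs
    -- Where the gauge is below δ the little-o condition applies; where it is at least δ, both
    -- symbols have real part at least 1/2 + δ.
    rcases lt_or_ge (contactGauge φ₀ φ₁ s) δ with h5 | h5
    · left
      have h6 := hδs (y := contactGauge φ₀ φ₁ s)
        (by rwa [dist_zero_right, Real.norm_of_nonneg h3.le]) s rfl hs
      rw [Real.norm_of_nonneg h3.le] at h6
      refine h6.trans ?_
      gcongr
      linarith
    · right
      have h6 := le_min_iff.1 (h5.trans h4)
      exact ⟨by linarith [h6.1], by linarith [h6.2]⟩
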